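/- Let $\mathfrak g$ be a (finite-dimensional) complex semisimple Lie algebra with Killing form $K$, Cartan subalgebra $\mathfrak h$, root system $\Phi$, a choice of positive roots $\Phi^+$ (put $\Phi^-=-\Phi^+$), Weyl group $W$ with identity $e$, root spaces $\mathfrak g_\alpha$, and $\mathfrak n=\bigoplus_{\alpha\in\Phi^+}\mathfrak g_\alpha$, $\mathfrak n_-=\bigoplus_{\alpha\in\Phi^+}\mathfrak g_{-\alpha}$. For $\alpha\in\Phi$ let $H_\alpha\in[\mathfrak g_\alpha,\mathfrak g_{-\alpha}]$ be the coroot, so $\alpha(H_\alpha)=2$, let $s_\alpha$ be the reflection in $\alpha$, and let $E_\alpha\in\mathfrak g_\alpha$ be the root vectors of a Chevalley basis. For $w\in W$ put $w\cdot\mathfrak n=\bigoplus_{\alpha\in\Phi^+}\mathfrak g_{w\alpha}$, $w\cdot\mathfrak n_-=\bigoplus_{\alpha\in\Phi^+}\mathfrak g_{-w\alpha}$ and $\Phi_w=\{\alpha\in\Phi^+: w^{-1}\alpha\in\Phi^-\}$. For a subspace $U\subseteq\mathfrak g$ put $U_{\Delta}=\{(x,x):x\in U\}$ and $U_{-\Delta}=\{(x,-x):x\in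 U\}$. Fix a non-zero scalar multiple $\langle\langle\cdot,\cdot\rangle\rangle=cK$ of the Killing form and equip $\mathfrak g\oplus\mathfrak g$ with the form $\langle(x_1,y_1),(x_2,y_2)\rangle=\langle\langle x_1,x_2\rangle\rangle-\langle\langle y_1,y_2\rangle\rangle$. Give $\mathfrak g$ the standard Lie bialgebra structure, that is, identify $\mathfrak g$ with $\mathfrak g_\Delta$ and $\mathfrak g^*$, as a Lie algebra, with $\mathfrak h_{-\Delta}+(\mathfrak n,0)+(0,\mathfrak n_-)$. For a subspace $\mathfrak m\subseteq\mathfrak g$ let $\mathfrak m^\perp=\{p\in\mathfrak g^*:\langle p,(z,z)\rangle=0\text{ for all }z\in\mathfrak m\}$; a Lie subalgebra $\mathfrak m$ of $\mathfrak g$ is coisotropic if $\mathfrak m^\perp$ is a Lie subalgebra of $\mathfrak g^*$. Let $\mathcal{CL}(\mathfrak g\oplus\mathfrak g)$ be the set of Lagrangian subalgebras $\mathfrak l$ of $\mathfrak g\oplus\mathfrak g$ (isotropic Lie subalgebras of dimension $\dim\mathfrak g$) of the form $\mathfrak l=\mathfrak m_\Delta\oplus\mathfrak m^\perp$ with $\mathfrak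 m$ a coisotropic subalgebra; then write $\mathfrak c(\mathfrak l)=\mathfrak m$. For a subspace $V\subseteq\mathfrak h$ with orthogonal complement $V^\perp$ in $\mathfrak h$, and $u,v\in W$, put $$\mathfrak l_{V,u,v}=V_\Delta+(V^\perp)_{-\Delta}+(u\cdot\mathfrak n,0)+(0,v\cdot\mathfrak n_-).$$ Let $\pi=\sum_{\alpha\in\Phi^+}\lambda_\alpha E_\alpha\wedge E_{-\alpha}$ with $\lambda_\alpha=1/K(E_\alpha,E_{-\alpha})$. For $\gamma\in\Phi$ let $\mathfrak u_{\gamma}=[E_{\gamma},\pi]^\sharp\mathfrak g^*$, where $[E_\gamma,\cdot]$ is the adjoint action on $\mathfrak g\wedge\mathfrak g$ and $r^\sharp:\mathfrak g^*\to\mathfrak g$ is contraction of the bivector $r$ with a linear form. Let $\beta\in\Phi^+$ be a long root, meaning that no root in the irreducible component of $\Phi$ containing $\beta$ is strictly longer than $\beta$. Then $$(\mathfrak u_\beta)_\Delta+\mathfrak u_\beta^\perp=\mathfrak l_{\mathbb CH_\beta,e,s_\beta},\qquad(\mathfrak u_{-\beta})_\Delta+\mathfrak u_{-\beta}^\perp=\mathfrak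 l_{\mathbb CH_\beta,s_\beta,e},$$ and both of these subspaces lie in $\mathcal{CL}(\mathfrak g\oplus\mathfrak g)$. Moreover $\Phi_w\cap\Phi_e=\emptyset$ for all $w\in W$, and $\mathfrak u_\beta$ and $\mathfrak u_{-\beta}$ are the coisotropic subalgebras attached to these Lagrangian subalgebras: the sums above are direct, $\mathfrak u_{\pm\beta}$ are coisotropic subalgebras of $\mathfrak g$, and $$\mathfrak u_\beta=\mathfrak c(\mathfrak l_{\mathbb CH_\beta,e,s_\beta}),\qquad \mathfrak u_{-\beta}=\mathfrak c(\mathfrak l_{\mathbb CH_\beta,s_\beta,e}).$$ These are instances of the general formula $V+\bigoplus_{\alpha\in\Phi_u}\mathfrak g_{-\alpha}+\bigoplus_{\alpha\in\Phi_v}\mathfrak g_\alpha$ with $V=\mathbb CH_\beta$ and $(u,v)=(e,s_\beta)$, respectively $(s_\beta,e)$: $$\mathfrak u_\beta=\mathbb CH_\beta+\bigoplus_{\alpha\in\Phi_{s_\beta}}\mathfrak g_\alpha,\qquad \mathfrak u_{-\beta}=\mathbb CH_\beta+\bigoplus_{\alpha\in\Phi_{s_\beta}}\mathfrak g_{-\alpha}.$$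 -/

import Mathlib

open LieAlgebra LieAlgebra.IsKilling
open scoped TensorProduct

noncomputable section

namespace Coisotropic

/-! ### Linear algebra in `𝔤`, `𝔤 ⊗ 𝔤` and `𝔤 ⊕ 𝔤` -/

section General

variable {L : Type*} [LieRing L] [LieAlgebra ℂ L]

/-- `𝔲_Δ = {(x, x) | x ∈ 𝔲}`. -/
def diag (U : Submodule ℂ L) : Submodule ℂ (L × L) :=
  U.map (LinearMap.prod LinearMap.id LinearMap.id)

/-- `𝔲_{-Δ} = {(x, -x) | x ∈ 𝔲}`. -/
def antidiag (U : Submodule ℂ L) : Submodule ℂ (L × L) :=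
  U.map (LinearMap.prod LinearMap.id (-LinearMap.id))

variable (L) in
/-- `⟪x, y⟫ = c K(x, y)`, the multiple of the Killing form by the scalar `c`. -/
def scaledKilling (c : ℂ) : LinearMap.BilinForm ℂ L := c • killingForm ℂ L

variable (L) in
/-- The form `⟨(x₁, y₁), (x₂, y₂)⟩ = ⟪x₁, x₂⟫ - ⟪y₁, y₂⟫` on `𝔤 ⊕ 𝔤`. -/
def doubleForm (c : ℂ) : LinearMap.BilinForm ℂ (L × L) :=
  (scaledKilling L c).compl₁₂ (LinearMap.fst ℂ L L) (LinearMap.fst ℂ L L) -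
    (scaledKilling L c).compl₁₂ (LinearMap.snd ℂ L L) (LinearMap.snd ℂ L L)

/-- A subspace that is closed under the Lie bracket. -/
def IsLieClosed {D : Type*} [LieRing D] [LieAlgebra ℂ D] (S : Submodule ℂ D) : Prop :=
  ∀ x ∈ S, ∀ y ∈ S, ⁅x, y⁆ ∈ S

/-- Lagrangian subalgebras of a Lie algebra `D` with a bilinear form `B`: isotropic Lie
subalgebras of half the dimension of `D`. -/
structure IsLagrangian {D : Type*} [LieRing D] [LieAlgebra ℂ D] (B : LinearMap.BilinForm ℂ D)
    (l : Submodule ℂ D) : Prop where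
  lie_mem : IsLieClosed l
  two_mul_finrank : 2 * Module.finrank ℂ l = Module.finrank ℂ D
  isotropic : ∀ x ∈ l, ∀ y ∈ l, B x y = 0

/-- The bivector `x ∧ y`, as an antisymmetric tensor. -/
def wedge (x y : L) : L ⊗[ℂ] L := x ⊗ₜ[ℂ] y - y ⊗ₜ[ℂ] x

/-- The map `r^♯ : 𝔤* → 𝔤` given by `μ (r^♯ ξ) = r (ξ, μ)`, that is, contraction of the first
tensor factor of `r` with `ξ`. -/
def sharp (r : L ⊗[ℂ] L) : Module.Dual ℂ L →ₗ[ℂ] L where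
  toFun ξ := TensorProduct.lid ℂ L (LinearMap.rTensor L ξ r)
  map_add' ξ η := by simp [LinearMap.rTensor_add]
  map_smul' a ξ := by simp [LinearMap.rTensor_smul]

end General

/-! ### Roots, Weyl group and root vectors -/

variable {L : Type*} [LieRing L] [LieAlgebra ℂ L] [FiniteDimensional ℂ L] [IsKilling ℂ L]
variable {H : LieSubalgebra ℂ L} [H.IsCartanSubalgebra]

/-- The root `-α`. -/
def negRoot (α : H.root) : H.root :=
  ⟨-α.1, by
    have h : α.1.IsNonZero := (LieSubalgebra.isNonZero_coe_root α)
    simpa using h⟩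

/-- The set `Φ⁺` of positive roots determined by a base. -/
def posRoots (b : (rootSystem H).Base) : Set H.root := {α | b.IsPos α}

/-- The set `Φ⁻ = -Φ⁺` of negative roots. -/
def negRoots (b : (rootSystem H).Base) : Set H.root := {α | negRoot α ∈ posRoots b}

/-- `Φ_w = {α ∈ Φ⁺ | w⁻¹ α ∈ Φ⁻}`. -/
def inversions (b : (rootSystem H).Base) (w : (rootSystem H).weylGroup) : Set H.root :=
  {α | α ∈ posRoots b ∧ w⁻¹ • α ∈ negRoots b}

/-- The reflection `s_β` as an element of the Weyl group. -/
def reflectionOf (β : H.root) : (rootSystem H).weylGroup :=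
  RootPairing.weylGroup.ofIdx (rootSystem H) β

/-- The sum of the root spaces `𝔤_α` over the roots `α ∈ S`. -/
def rootSpaces (S : Set H.root) : Submodule ℂ L :=
  ⨆ α ∈ S, (rootSpace H (α.1 : H → ℂ)).toSubmodule

/-- `w · 𝔫`, the sum of the root spaces of `w Φ⁺`; for `w = 1` this is `𝔫`. -/
def posNilp (b : (rootSystem H).Base) (w : (rootSystem H).weylGroup) : Submodule ℂ L :=
  rootSpaces ((fun α => w • α) '' posRoots b)

/-- `w · 𝔫₋`, the sum of the root spaces of `w Φ⁻`; for `w = 1` this is `𝔫₋`. -/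
def negNilp (b : (rootSystem H).Base) (w : (rootSystem H).weylGroup) : Submodule ℂ L :=
  rootSpaces ((fun α => w • α) '' negRoots b)

/-- The family `E` of root vectors is the root part of a Chevalley basis: `E_α ∈ 𝔤_α`,
`[E_α, E_{-α}] = H_α`, and if `[E_α, E_β] = N E_{α+β}` with `α`, `β`, `α + β` roots, then
`[E_{-α}, E_{-β}] = -N E_{-α-β}`. (The remaining members of a Chevalley basis are the simple
coroots, which involve no choice.) -/
structure IsChevalley (E : H.root → L) : Prop where
  mem_rootSpace : ∀ α : H.root, E α ∈ rootSpace H (α.1 : H → ℂ)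
  lie_neg : ∀ α : H.root, ⁅E α, E (negRoot α)⁆ = ((coroot α.1 : H) : L)
  structure_constant : ∀ α β γ : H.root, (γ.1 : H → ℂ) = (α.1 : H → ℂ) + (β.1 : H → ℂ) →
    ∀ N : ℂ, ⁅E α, E β⁆ = N • E γ → ⁅E (negRoot α), E (negRoot β)⁆ = -N • E (negRoot γ)

/-- The squared length `(α, α) = K(t_α, t_α)`, where `t_α ∈ 𝔥` represents `α` with respect to the
Killing form `K`; this number is real. -/
def lengthSq (α : H.root) : ℝ :=
  (killingForm ℂ L ((cartanEquivDual H).symm (α.1.toLinear) : H)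
    ((cartanEquivDual H).symm (α.1.toLinear) : H)).re

/-- `α` and `β` lie in the same irreducible component of the root system: they are joined by a
chain of roots in which consecutive members are not orthogonal. -/
def SameComponent (α β : H.root) : Prop :=
  Relation.ReflTransGen (fun γ δ => ¬ (rootSystem H).IsOrthogonal γ δ) α β

/-- `β` is a long root: no root in its irreducible component is strictly longer. -/
def IsLong (β : H.root) : Prop :=
  ¬ ∃ α : H.root, SameComponent β α ∧ lengthSq β < lengthSq α

/-! ### Zambon's subalgebras -/

open Classical in
/-- `π = ∑_{α ∈ Φ⁺} λ_α E_α ∧ E_{-α}` with `λ_α = 1 / K(E_α, E_{-α})`. -/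
def bivector (b : (rootSystem H).Base) (E : H.root → L) : L ⊗[ℂ] L :=
  ∑ α : H.root with α ∈ posRoots b,
    (1 / killingForm ℂ L (E α) (E (negRoot α))) • wedge (E α) (E (negRoot α))

/-- `𝔲_β = [E_β, π]^♯ 𝔤*`, for an arbitrary root `β`. -/
def zambon (b : (rootSystem H).Base) (E : H.root → L) (β : H.root) : Submodule ℂ L :=
  LinearMap.range (sharp ⁅E β, bivector b E⁆)

/-! ### The standard Lie bialgebra structure and coisotropic subalgebras

The Manin triple `(𝔤 ⊕ 𝔤, 𝔤_Δ, 𝔥_{-Δ} + (𝔫, 0) + (0, 𝔫₋))` identifies `𝔤*`, with the Lie bracket of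
the standard Lie bialgebra structure, with its third member. -/

/-- `𝔤* = 𝔥_{-Δ} + (𝔫, 0) + (0, 𝔫₋)`. -/
def stdDual (b : (rootSystem H).Base) : Submodule ℂ (L × L) :=
  antidiag H.toSubmodule ⊔ (posNilp b 1).prod ⊥ ⊔ (⊥ : Submodule ℂ L).prod (negNilp b 1)

/-- `𝔪^⊥`, the annihilator of `𝔪` in `𝔤*`: all `p ∈ 𝔤*` with `⟨p, (z, z)⟩ = 0` for all `z ∈ 𝔪`. -/
def perp (c : ℂ) (b : (rootSystem H).Base) (m : Submodule ℂ L) : Submodule ℂ (L × L) where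
  carrier := {p | p ∈ stdDual b ∧ ∀ z ∈ m, doubleForm L c p (z, z) = 0}
  add_mem' hp hq := ⟨add_mem hp.1 hq.1, fun z hz => by
    rw [map_add, LinearMap.add_apply, hp.2 z hz, hq.2 z hz, add_zero]⟩
  zero_mem' := ⟨zero_mem _, fun z _ => by rw [map_zero, LinearMap.zero_apply]⟩
  smul_mem' a p hp := ⟨Submodule.smul_mem _ a hp.1, fun z hz => by
    rw [map_smul, LinearMap.smul_apply, hp.2 z hz, smul_zero]⟩

/-- `𝔪` is a coisotropic subalgebra of `𝔤`: it is a Lie subalgebra, and its annihilator in `𝔤*` is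
a Lie subalgebra of `𝔤*`. -/
structure IsCoisotropic (c : ℂ) (b : (rootSystem H).Base) (m : Submodule ℂ L) : Prop where
  lie_mem : IsLieClosed m
  perp_lie_mem : IsLieClosed (perp c b m)

/-- `𝔠(𝔩) = 𝔪`: the coisotropic subalgebra `𝔪` satisfies `𝔩 = 𝔪_Δ ⊕ 𝔪^⊥`. -/
structure Corresponds (c : ℂ) (b : (rootSystem H).Base) (l : Submodule ℂ (L × L))
    (m : Submodule ℂ L) : Prop where
  isCoisotropic : IsCoisotropic c b m
  sup_eq : diag m ⊔ perp c b m = l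
  disjoint : Disjoint (diag m) (perp c b m)

/-- `𝒞ℒ(𝔤 ⊕ 𝔤)`: the Lagrangian subalgebras `𝔪_Δ ⊕ 𝔪^⊥` of `𝔤 ⊕ 𝔤` with `𝔪` coisotropic. -/
def CL (c : ℂ) (b : (rootSystem H).Base) : Set (Submodule ℂ (L × L)) :=
  {l | IsLagrangian (doubleForm L c) l ∧ ∃ m : Submodule ℂ L, Corresponds c b l m}

/-! ### The subspaces `𝔩_{V,u,v}` -/

/-- `V^⊥ ⊆ 𝔥`, for a subspace `V` of `𝔥`. -/
def cartanPerp (c : ℂ) (V : Submodule ℂ H) : Submodule ℂ H :=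
  ((scaledKilling L c).restrict H.toSubmodule).orthogonal V

/-- `𝔩_{V,u,v} = V_Δ + (V^⊥)_{-Δ} + (u · 𝔫, 0) + (0, v · 𝔫₋)`. -/
def lagr (c : ℂ) (b : (rootSystem H).Base) (V : Submodule ℂ H) (u v : (rootSystem H).weylGroup) :
    Submodule ℂ (L × L) :=
  diag (V.map H.toSubmodule.subtype) ⊔ antidiag ((cartanPerp c V).map H.toSubmodule.subtype) ⊔
    (posNilp b u).prod ⊥ ⊔ (⊥ : Submodule ℂ L).prod (negNilp b v)

/-- `V + ⨁_{α ∈ Φ_u} 𝔤_{-α} + ⨁_{α ∈ Φ_v} 𝔤_α`. -/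
def coisotropicOf (b : (rootSystem H).Base) (V : Submodule ℂ H)
    (u v : (rootSystem H).weylGroup) : Submodule ℂ L :=
  V.map H.toSubmodule.subtype ⊔ rootSpaces (negRoot '' inversions b u) ⊔
    rootSpaces (inversions b v)

/-- The line `ℂ H_β` in `𝔥`. -/
def corootLine (β : H.root) : Submodule ℂ H := Submodule.span ℂ {coroot β.1}

end Coisotropic

end

open Coisotropic

set_option linter.unusedSectionVars false

noncomputable section

namespace Coisotropic

section General

variable {L : Type*} [LieRing L] [LieAlgebra ℂ L]

/-! The Killing form identifies 𝔤* with 𝔤. Then π^♯ becomes the operator that kills 𝔥 and multiplies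
root vectors by minus the sign of their root (`contraction_bivector_rootSpace`). By invariance of K,
[E_δ, π]^♯ becomes the commutator of ad E_δ with this operator (`contraction_lie`). It sends 𝔥 to
ℂE_δ, E_{-δ} to a multiple of H_δ, and E_γ to (sign(γ+δ) - sign γ)[E_δ, E_γ]. So 𝔲_δ is spanned by
H_δ, E_δ and those [E_δ, E_γ] for which adding δ changes the sign of γ.

Length enters only through `IsLong.apply_coroot_eq`: the roots other than ±δ have Cartan integers
-1, 0, 1 with δ. Hence, if γ and ε = γ + δ are roots of opposite signs, then γ = s_δ ε, and 𝔲_δ is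
ℂH_δ plus the root spaces of the roots with the sign of δ whose sign s_δ changes (`zambon_eq`). For
δ = ±β these are ±Φ_{s_β}.

The rest holds for all V, u, v with Φ_u ∩ Φ_v = ∅. The space 𝔩_{V,u,v} is closed under the bracket
and is its own orthogonal complement, hence Lagrangian (`isLagrangian_lagr`). Testing one root space
at a time shows that it is 𝔪_Δ + 𝔪^⊥ for 𝔪 = `coisotropicOf b V u v` (`corresponds_coisotropicOf`).
Since 𝔤_Δ ∩ 𝔤* = 0, closure of the sum under the bracket forces closure of both summands, which
makes 𝔪 coisotropic. -/

lemma killingForm_comm (x y : L) : killingForm ℂ L x y = killingForm ℂ L y x :=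
  LieModule.traceForm_comm ℂ L L x y

lemma killingForm_lie_left (x y z : L) :
    killingForm ℂ L ⁅x, y⁆ z = -killingForm ℂ L y ⁅x, z⁆ := by
  rw [← lie_skew, map_neg, LinearMap.neg_apply, LieModule.traceForm_apply_lie_apply]

end General

variable {L : Type*} [LieRing L] [LieAlgebra ℂ L] [FiniteDimensional ℂ L] [IsKilling ℂ L]
variable {H : LieSubalgebra ℂ L} [H.IsCartanSubalgebra]

/-! ### Roots -/

lemma root_ext {α β : H.root} (h : (α.1 : H → ℂ) = β.1) : α = β :=
  Subtype.ext (DFunLike.coe_injective h)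

@[simp] lemma coe_negRoot (α : H.root) : ((negRoot α).1 : H → ℂ) = -(α.1 : H → ℂ) := rfl

@[simp] lemma negRoot_negRoot (α : H.root) : negRoot (negRoot α) = α :=
  root_ext (by simp)

lemma negRoot_injective : Function.Injective (negRoot (H := H)) :=
  fun α β h => by rw [← negRoot_negRoot α, h, negRoot_negRoot]

lemma coe_root_ne_zero (α : H.root) : (α.1 : H → ℂ) ≠ 0 :=
  LieSubalgebra.isNonZero_coe_root α

lemma apply_coroot_self (α : H.root) : α.1 (coroot α.1) = 2 :=
  root_apply_coroot (LieSubalgebra.isNonZero_coe_root α)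

lemma negRoot_ne_self (α : H.root) : negRoot α ≠ α := fun h => by
  have h1 := apply_coroot_self α
  have h2 : (negRoot α).1 (coroot α.1) = -α.1 (coroot α.1) := rfl
  rw [h, h1] at h2
  norm_num at h2

lemma coroot_negRoot (α : H.root) : (coroot (negRoot α).1 : H) = -coroot α.1 :=
  coroot_neg α.1

lemma root_negRoot (α : H.root) :
    (rootSystem H).root (negRoot α) = -(rootSystem H).root α := rfl

lemma root_eq_add {α β γ : H.root} (h : (γ.1 : H → ℂ) = (α.1 : H → ℂ) + (β.1 : H → ℂ)) :
    (rootSystem H).root γ = (rootSystem H).root α + (rootSystem H).root β := by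
  ext x
  exact congrFun h x

lemma coe_eq_add {α β γ : H.root}
    (h : (rootSystem H).root γ = (rootSystem H).root α + (rootSystem H).root β) :
    (γ.1 : H → ℂ) = (α.1 : H → ℂ) + (β.1 : H → ℂ) := by
  ext x
  exact LinearMap.congr_fun h x

lemma root_smul (w : (rootSystem H).weylGroup) (α : H.root) :
    (rootSystem H).root (w • α) = w • (rootSystem H).root α :=
  (RootPairing.weylGroup_apply_root _ w α).symm

lemma smul_negRoot (w : (rootSystem H).weylGroup) (α : H.root) :
    w • negRoot α = negRoot (w • α) := by
  apply (rootSystem H).root.injective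
  rw [root_smul, root_negRoot, root_negRoot, root_smul, smul_neg]

lemma coe_smul_eq_add (w : (rootSystem H).weylGroup) {α β γ : H.root}
    (h : (γ.1 : H → ℂ) = (α.1 : H → ℂ) + (β.1 : H → ℂ)) :
    ((w • γ).1 : H → ℂ) = ((w • α).1 : H → ℂ) + ((w • β).1 : H → ℂ) := by
  apply coe_eq_add
  rw [root_smul, root_smul, root_smul, root_eq_add h, smul_add]

lemma coe_reflectionOf_smul (β α : H.root) :
    ((reflectionOf β • α).1 : H → ℂ) = α.1 - α.1 (coroot β.1) • (β.1 : H → ℂ) := by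
  have h : (rootSystem H).root (reflectionOf β • α) =
      (rootSystem H).root α - α.1 (coroot β.1) • (rootSystem H).root β := by
    rw [root_smul]
    exact (rootSystem H).reflection_apply_root β α
  ext x
  exact LinearMap.congr_fun h x

lemma reflectionOf_inv (β : H.root) : (reflectionOf β)⁻¹ = reflectionOf β :=
  Subtype.ext (RootPairing.Equiv.reflection_inv (rootSystem H) β)

variable (b : (rootSystem H).Base)

lemma negRoot_mem_posRoots_iff (α : H.root) : negRoot α ∈ posRoots b ↔ α ∉ posRoots b := by
  have h := RootPairing.Base.IsPos.neg_iff_not b α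
  have e : (rootSystem H).indexNeg.neg α = negRoot α := by
    apply (rootSystem H).root.injective
    rw [root_negRoot, RootPairing.indexNeg_neg, RootPairing.root_reflectionPerm,
      RootPairing.reflection_apply_self]
  rw [← e]
  exact h

lemma mem_negRoots_iff (α : H.root) : α ∈ negRoots b ↔ α ∉ posRoots b :=
  negRoot_mem_posRoots_iff b α

variable {b} in
lemma add_mem_posRoots {α β γ : H.root} (hα : α ∈ posRoots b) (hβ : β ∈ posRoots b)
    (h : (γ.1 : H → ℂ) = (α.1 : H → ℂ) + (β.1 : H → ℂ)) : γ ∈ posRoots b :=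
  RootPairing.Base.IsPos.add hα hβ (root_eq_add h)

variable {b} in
lemma add_notMem_posRoots {α β γ : H.root} (hα : α ∉ posRoots b) (hβ : β ∉ posRoots b)
    (h : (γ.1 : H → ℂ) = (α.1 : H → ℂ) + (β.1 : H → ℂ)) : γ ∉ posRoots b := by
  rw [← negRoot_mem_posRoots_iff] at hα hβ ⊢
  refine add_mem_posRoots hα hβ ?_
  rw [coe_negRoot, coe_negRoot, coe_negRoot, h]
  abel

lemma mem_smul_posRoots_iff (w : (rootSystem H).weylGroup) (α : H.root) :
    α ∈ (fun γ => w • γ) '' posRoots b ↔ w⁻¹ • α ∈ posRoots b := by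
  constructor
  · rintro ⟨γ, hγ, rfl⟩
    simpa using hγ
  · exact fun h => ⟨_, h, by simp⟩

lemma mem_smul_negRoots_iff (w : (rootSystem H).weylGroup) (α : H.root) :
    α ∈ (fun γ => w • γ) '' negRoots b ↔ w⁻¹ • α ∉ posRoots b := by
  rw [← mem_negRoots_iff]
  constructor
  · rintro ⟨γ, hγ, rfl⟩
    simpa using hγ
  · exact fun h => ⟨_, h, by simp⟩

lemma mem_inversions_iff (w : (rootSystem H).weylGroup) (α : H.root) :
    α ∈ inversions b w ↔ α ∈ posRoots b ∧ w⁻¹ • α ∉ posRoots b := by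
  rw [← mem_negRoots_iff]
  rfl

lemma inversions_one : inversions b 1 = ∅ := by
  ext α
  rw [mem_inversions_iff]
  simp

/-! ### Lengths of roots -/

/-- The squared length `(α, α)` as a complex number. -/
def complexLengthSq (α : H.root) : ℂ := α.1 ((cartanEquivDual H).symm α.1.toLinear)

lemma killingForm_cartanEquivDual_symm (α : H.root) (x : H) :
    killingForm ℂ L ((cartanEquivDual H).symm α.1.toLinear : H) x = α.1 x := by
  have h : cartanEquivDual H ((cartanEquivDual H).symm α.1.toLinear) x = α.1 x := by
    rw [LinearEquiv.apply_symm_apply, LieModule.Weight.toLinear_apply]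
  exact h

lemma lengthSq_eq_re (α : H.root) : lengthSq α = (complexLengthSq α).re := by
  rw [lengthSq, killingForm_cartanEquivDual_symm, complexLengthSq]

lemma complexLengthSq_ne_zero (α : H.root) : complexLengthSq α ≠ 0 :=
  root_apply_cartanEquivDual_symm_ne_zero (LieSubalgebra.isNonZero_coe_root α)

lemma killingForm_coroot (α : H.root) (x : H) :
    killingForm ℂ L (coroot α.1 : H) x = 2 * (complexLengthSq α)⁻¹ * α.1 x := by
  have h := traceForm_coroot α.1 x
  rw [nsmul_eq_mul, smul_eq_mul] at h
  rw [mul_assoc]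
  exact h

/-- K(H_α, H_β) can be evaluated through either coroot; symmetry of K gives the relation. -/
lemma apply_coroot_mul_complexLengthSq (α β : H.root) :
    α.1 (coroot β.1) * complexLengthSq β = β.1 (coroot α.1) * complexLengthSq α := by
  have h1 := killingForm_coroot α (coroot β.1)
  have h2 := killingForm_coroot β (coroot α.1)
  have h3 : killingForm ℂ L (coroot α.1 : H) (coroot β.1 : H) =
    killingForm ℂ L (coroot β.1 : H) (coroot α.1 : H) := LieModule.traceForm_comm ℂ L L _ _
  rw [h1, h2] at h3
  have hα := complexLengthSq_ne_zero α
  have hβ := complexLengthSq_ne_zero β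
  field_simp at h3
  linear_combination h3

lemma apply_coroot_eq_pairingIn (α β : H.root) :
    α.1 (coroot β.1) = ((rootSystem H).pairingIn ℤ α β : ℂ) := by
  rw [← rootSystem_pairing_apply, ← (rootSystem H).algebraMap_pairingIn ℤ]
  rfl

/-- K(H_α, H_α) is the sum of the squares of the Cartan integers of all roots with α, a positive
integer n. It is also 4/(α, α), so (α, α) = 4/n. -/
lemma lengthSq_pos (α : H.root) : 0 < lengthSq α := by
  have h1 : killingForm ℂ L (coroot α.1 : H) (coroot α.1 : H) =
      ((∑ γ : H.root, (rootSystem H).pairingIn ℤ γ α ^ 2 : ℤ) : ℂ) := by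
    have := congrArg (fun B => B (coroot α.1) (coroot α.1))
      (corootForm_rootSystem_eq_killing (H := H) (K := ℂ) (L := L))
    have h2 : killingForm ℂ L (coroot α.1 : H) (coroot α.1 : H) =
      (rootSystem H).CorootForm (coroot α.1) (coroot α.1) := this.symm
    rw [h2, RootPairing.corootForm_apply_apply, Int.cast_sum]
    refine Finset.sum_congr rfl fun γ _ => ?_
    rw [Int.cast_pow, ← apply_coroot_eq_pairingIn, sq]
    rfl
  have hpos : 0 < ∑ γ : H.root, (rootSystem H).pairingIn ℤ γ α ^ 2 := by
    refine Finset.sum_pos' (fun _ _ => sq_nonneg _) ⟨α, Finset.mem_univ _, ?_⟩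
    simp
  rw [killingForm_coroot, apply_coroot_self] at h1
  generalize (∑ γ : H.root, (rootSystem H).pairingIn ℤ γ α ^ 2 : ℤ) = n at h1 hpos
  have hn : (n : ℂ) ≠ 0 := by exact_mod_cast hpos.ne'
  have h3 : complexLengthSq α = ((4 / n : ℝ) : ℂ) := by
    have := complexLengthSq_ne_zero α
    push_cast
    field_simp at h1 ⊢
    linear_combination -h1
  rw [lengthSq_eq_re, h3, Complex.ofReal_re]
  have : (0 : ℝ) < n := by exact_mod_cast hpos
  positivity

/-- Roots other than `±β` have Cartan integers `-1`, `0` or `1` with respect to a long root `β`. -/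
lemma IsLong.apply_coroot_eq {β : H.root} (hβ : IsLong β) {γ : H.root} (h : γ ≠ β)
    (h' : γ ≠ negRoot β) :
    γ.1 (coroot β.1) = -1 ∨ γ.1 (coroot β.1) = 0 ∨ γ.1 (coroot β.1) = 1 := by
  have hmem := (rootSystem H).pairingIn_pairingIn_mem_set_of_isCrystal_of_isRed' γ β
    (fun e => h ((rootSystem H).root.injective e))
    (fun e => h' ((rootSystem H).root.injective (by rw [e, root_negRoot])))
  have key := apply_coroot_mul_complexLengthSq γ β
  have hβ0 := lengthSq_pos β
  rw [apply_coroot_eq_pairingIn, apply_coroot_eq_pairingIn β γ] at key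
  rw [apply_coroot_eq_pairingIn]
  have key' : ((rootSystem H).pairingIn ℤ γ β : ℝ) * lengthSq β =
      (rootSystem H).pairingIn ℤ β γ * lengthSq γ := by
    have := congrArg Complex.re key
    simpa [lengthSq_eq_re] using this
  -- A non-orthogonal γ lies in the component of β, one step along the chain, so it cannot be longer
  -- than β.
  have hle : (rootSystem H).pairingIn ℤ γ β ≠ 0 → lengthSq γ ≤ lengthSq β := by
    intro h0
    by_contra! hlt
    refine hβ ⟨γ, Relation.ReflTransGen.single fun ho => h0 ?_, hlt⟩
    have := (RootPairing.isOrthogonal_symm (rootSystem H) β γ |>.mp ho).1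
    have h2 := (rootSystem H).algebraMap_pairingIn ℤ γ β
    rw [this] at h2
    simpa using h2
  generalize (rootSystem H).pairingIn ℤ γ β = p at *
  generalize (rootSystem H).pairingIn ℤ β γ = q at *
  simp only [Set.mem_insert_iff, Set.mem_singleton_iff, Prod.mk.injEq] at hmem
  -- The pairs with first entry ±2 or ±3 have second entry ±1 and would make γ strictly longer than
  -- β.
  rcases hmem with h | h | h | h | h | h | h | h | h | h | h <;> obtain ⟨rfl, rfl⟩ := h <;>
    first
    | (norm_num; done)
    | (have := hle (by norm_num)
       push_cast at key'
       linarith)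

/-! ### Root spaces and the Killing form -/

variable (H) in
lemma mem_rootSpace_zero_iff (x : L) : x ∈ rootSpace H (0 : H → ℂ) ↔ x ∈ H := by
  rw [rootSpace_zero_eq]
  exact LieSubalgebra.mem_toLieSubmodule _

lemma killingForm_cartan_rootSpace {h x : L} (hh : h ∈ H) {α : H.root}
    (hx : x ∈ rootSpace H (α.1 : H → ℂ)) : killingForm ℂ L h x = 0 :=
  killingForm_apply_eq_zero_of_mem_rootSpace_of_add_ne_zero ℂ L H
    ((mem_rootSpace_zero_iff H h).mpr hh) hx (by simp [coe_root_ne_zero α])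

lemma killingForm_rootSpace_rootSpace {α β : H.root} {x y : L}
    (hx : x ∈ rootSpace H (α.1 : H → ℂ)) (hy : y ∈ rootSpace H (β.1 : H → ℂ))
    (h : β ≠ negRoot α) : killingForm ℂ L x y = 0 :=
  killingForm_apply_eq_zero_of_mem_rootSpace_of_add_ne_zero ℂ L H hx hy
    (fun e => h (root_ext (by rw [coe_negRoot]; exact (neg_eq_of_add_eq_zero_right e).symm)))

lemma mem_rootSpaces {S : Set H.root} {α : H.root} (hα : α ∈ S) {x : L}
    (hx : x ∈ rootSpace H (α.1 : H → ℂ)) : x ∈ rootSpaces S :=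
  Submodule.mem_iSup_of_mem α (Submodule.mem_iSup_of_mem hα hx)

lemma rootSpaces_le {S : Set H.root} {p : Submodule ℂ L}
    (h : ∀ α ∈ S, ∀ x ∈ rootSpace H (α.1 : H → ℂ), x ∈ p) : rootSpaces S ≤ p :=
  iSup₂_le h

lemma rootSpaces_mono {S T : Set H.root} (h : S ⊆ T) : rootSpaces S ≤ rootSpaces T :=
  rootSpaces_le fun _ hα _ hx => mem_rootSpaces (h hα) hx

lemma rootSpaces_empty : rootSpaces (∅ : Set H.root) = ⊥ :=
  eq_bot_iff.mpr (rootSpaces_le fun _ h => h.elim)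

variable (H) in
lemma cartan_sup_rootSpaces_univ :
    H.toSubmodule ⊔ rootSpaces (Set.univ : Set H.root) = ⊤ := by
  have h := congrArg LieSubmodule.toSubmodule (cartan_sup_iSup_rootSpace_eq_top (K := ℂ) (H := H))
  rw [LieSubmodule.sup_toSubmodule, LieSubmodule.top_toSubmodule] at h
  rw [eq_top_iff, ← h]
  refine sup_le_sup le_rfl ?_
  simp only [LieSubmodule.iSup_toSubmodule]
  refine iSup₂_le fun α hα x hx => ?_
  exact mem_rootSpaces (α := ⟨α, by simpa using hα⟩) (Set.mem_univ _) hx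

lemma exists_cartan_add_rootSpaces (x : L) :
    ∃ h ∈ H, ∃ n ∈ rootSpaces (Set.univ : Set H.root), h + n = x := by
  have : x ∈ H.toSubmodule ⊔ rootSpaces (Set.univ : Set H.root) := by
    rw [cartan_sup_rootSpaces_univ]
    trivial
  exact Submodule.mem_sup.mp this

lemma killingForm_cartan_rootSpaces {h x : L} (hh : h ∈ H) {S : Set H.root}
    (hx : x ∈ rootSpaces S) : killingForm ℂ L h x = 0 := by
  have : rootSpaces S ≤ LinearMap.ker (killingForm ℂ L h) :=
    rootSpaces_le fun α _ y hy => killingForm_cartan_rootSpace hh hy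
  exact this hx

lemma killingForm_rootSpace_rootSpaces {α : H.root} {x y : L}
    (hx : x ∈ rootSpace H (α.1 : H → ℂ)) {S : Set H.root} (h : negRoot α ∉ S)
    (hy : y ∈ rootSpaces S) : killingForm ℂ L x y = 0 := by
  have : rootSpaces S ≤ LinearMap.ker (killingForm ℂ L x) :=
    rootSpaces_le fun β hβ y hy =>
      killingForm_rootSpace_rootSpace hx hy fun e => h (e ▸ hβ)
  exact this hy

lemma killingForm_rootSpaces_rootSpaces {S T : Set H.root} (h : ∀ α ∈ S, negRoot α ∉ T) {x y : L}
    (hx : x ∈ rootSpaces S) (hy : y ∈ rootSpaces T) : killingForm ℂ L x y = 0 := by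
  have : rootSpaces S ≤ LinearMap.ker ((killingForm ℂ L).flip y) :=
    rootSpaces_le fun α hα x hx => killingForm_rootSpace_rootSpaces hx (h α hα) hy
  exact this hx

lemma eq_zero_of_killingForm_eq_zero {x : L} (h : ∀ y, killingForm ℂ L x y = 0) : x = 0 := by
  have : x ∈ LinearMap.ker (killingForm ℂ L) := LinearMap.ext h
  simpa using this

lemma eq_zero_of_killingForm_cartan_rootSpace {x : L} (h : ∀ y ∈ H, killingForm ℂ L x y = 0)
    (h' : ∀ α : H.root, ∀ y ∈ rootSpace H (α.1 : H → ℂ), killingForm ℂ L x y = 0) : x = 0 := by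
  refine eq_zero_of_killingForm_eq_zero fun y => ?_
  obtain ⟨k, hk, n, hn, rfl⟩ := exists_cartan_add_rootSpaces (H := H) y
  have : rootSpaces (Set.univ : Set H.root) ≤ LinearMap.ker (killingForm ℂ L x) :=
    rootSpaces_le fun α _ => h' α
  rw [map_add, h k hk, this hn, add_zero]

/-- Directness of the root decomposition, read off from nondegeneracy of K: 𝔤_α pairs only with
𝔤_{-α}, and -α is missing from S or from T. -/
lemma eq_zero_of_mem_rootSpaces_of_mem_rootSpaces {S T : Set H.root} (hST : Disjoint S T) {x : L}
    (hS : x ∈ rootSpaces S) (hT : x ∈ rootSpaces T) : x = 0 := by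
  refine eq_zero_of_killingForm_cartan_rootSpace (H := H)
    (fun y hy => by rw [killingForm_comm]; exact killingForm_cartan_rootSpaces hy hS)
    fun α y hy => ?_
  rw [killingForm_comm]
  by_cases h : negRoot α ∈ S
  · exact killingForm_rootSpace_rootSpaces hy (Set.disjoint_left.mp hST h) hT
  · exact killingForm_rootSpace_rootSpaces hy h hS

lemma eq_zero_of_mem_cartan_of_mem_rootSpaces {S : Set H.root} {x : L}
    (hH : x ∈ H) (hS : x ∈ rootSpaces S) : x = 0 :=
  eq_zero_of_killingForm_cartan_rootSpace (H := H)
    (fun y hy => by rw [killingForm_comm]; exact killingForm_cartan_rootSpaces hy hS)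
    fun _ y hy => killingForm_cartan_rootSpace hH hy

/-- A vector orthogonal to all root spaces `𝔤_{-α}`, `α ∉ S`, has its root components in `S`. -/
lemma exists_cartan_add_of_orthogonal {S : Set H.root} {x : L}
    (h : ∀ α ∉ S, ∀ y ∈ rootSpace H ((negRoot α).1 : H → ℂ), killingForm ℂ L x y = 0) :
    ∃ k ∈ H, ∃ n ∈ rootSpaces S, k + n = x := by
  obtain ⟨k, hk, n, hn, rfl⟩ := exists_cartan_add_rootSpaces (H := H) x
  refine ⟨k, hk, n, ?_, rfl⟩
  have hsup : rootSpaces (Set.univ : Set H.root) ≤ rootSpaces S ⊔ rootSpaces Sᶜ := by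
    refine rootSpaces_le fun α _ x hx => ?_
    by_cases hα : α ∈ S
    · exact Submodule.mem_sup_left (mem_rootSpaces hα hx)
    · exact Submodule.mem_sup_right (mem_rootSpaces hα hx)
  obtain ⟨m, hm, m', hm', rfl⟩ := Submodule.mem_sup.mp (hsup hn)
  have : m' = 0 := by
    refine eq_zero_of_killingForm_cartan_rootSpace (H := H)
      (fun y hy => by rw [killingForm_comm]; exact killingForm_cartan_rootSpaces hy hm')
      fun α y hy => ?_
    by_cases hα : negRoot α ∈ S
    · rw [killingForm_comm]
      exact killingForm_rootSpace_rootSpaces hy (by simpa using hα) hm'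
    · have h1 := h (negRoot α) hα y (by rwa [negRoot_negRoot])
      rwa [map_add, map_add, LinearMap.add_apply, LinearMap.add_apply,
        killingForm_cartan_rootSpace hk hy, killingForm_comm m,
        killingForm_rootSpace_rootSpaces hy hα hm, zero_add, zero_add] at h1
  rwa [this, add_zero]

lemma mem_rootSpaces_of_orthogonal {S T : Set H.root} {x : L} (hx : x ∈ rootSpaces T)
    (h : ∀ α ∈ T, α ∉ S → ∀ y ∈ rootSpace H ((negRoot α).1 : H → ℂ), killingForm ℂ L x y = 0) :
    x ∈ rootSpaces S := by
  obtain ⟨k, hk, n, hn, rfl⟩ := exists_cartan_add_of_orthogonal (S := S) (x := x) fun α hα y hy => by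
    by_cases hT : α ∈ T
    · exact h α hT hα y hy
    · rw [killingForm_comm]
      exact killingForm_rootSpace_rootSpaces hy (by rwa [negRoot_negRoot]) hx
  have hk' : k ∈ rootSpaces (Set.univ : Set H.root) := by
    have := sub_mem (rootSpaces_mono (Set.subset_univ _) hx) (rootSpaces_mono (Set.subset_univ _) hn)
    rwa [add_sub_cancel_right] at this
  rwa [eq_zero_of_mem_cartan_of_mem_rootSpaces hk hk', zero_add]

lemma lie_mem_rootSpace {χ ψ : H → ℂ} {x y : L} (hx : x ∈ rootSpace H χ) (hy : y ∈ rootSpace H ψ) :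
    ⁅x, y⁆ ∈ rootSpace H (χ + ψ) :=
  lie_mem_genWeightSpace_of_mem_genWeightSpace hx hy

lemma eq_zero_or_exists_root {χ : H → ℂ} {x : L} (hx : x ∈ rootSpace H χ) (hχ : χ ≠ 0) :
    x = 0 ∨ ∃ α : H.root, (α.1 : H → ℂ) = χ := by
  by_cases h : rootSpace H χ = ⊥
  · left
    rwa [h, LieSubmodule.mem_bot] at hx
  · right
    exact ⟨⟨⟨χ, h⟩, by
      have : (⟨χ, h⟩ : LieModule.Weight ℂ H L).IsNonZero := hχ
      simpa using this⟩, rfl⟩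

lemma exists_smul_eq_of_mem_rootSpace {α : H.root} {x y : L} (hx : x ∈ rootSpace H (α.1 : H → ℂ))
    (hx0 : x ≠ 0) (hy : y ∈ rootSpace H (α.1 : H → ℂ)) : ∃ a : ℂ, a • x = y := by
  have h := (finrank_eq_one_iff_of_nonzero' (⟨x, hx⟩ : rootSpace H (α.1 : H → ℂ))
    (by simpa using hx0)).mp
    (finrank_rootSpace_eq_one α.1 (LieSubalgebra.isNonZero_coe_root α)) ⟨y, hy⟩
  obtain ⟨a, ha⟩ := h
  exact ⟨a, congrArg Subtype.val ha⟩

lemma cartan_lie_mem_rootSpaces {S : Set H.root} {h x : L} (hh : h ∈ H) (hx : x ∈ rootSpaces S) :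
    ⁅h, x⁆ ∈ rootSpaces S := by
  have : rootSpaces S ≤ (rootSpaces S).comap (LieAlgebra.ad ℂ L h : L →ₗ[ℂ] L) :=
    rootSpaces_le fun α hα x hx => by
      have h1 : ⁅(⟨h, hh⟩ : H), x⁆ = α.1 ⟨h, hh⟩ • x := lie_eq_smul_of_mem_rootSpace hx _
      have h2 : ⁅h, x⁆ = α.1 ⟨h, hh⟩ • x := h1
      rw [Submodule.mem_comap, LieAlgebra.ad_apply, h2]
      exact Submodule.smul_mem _ _ (mem_rootSpaces hα hx)
  exact this hx

/-- Excluding opposite pairs keeps brackets of root vectors out of 𝔥, so only closure under addition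
is left to use. -/
lemma lie_mem_rootSpaces {S : Set H.root} (hneg : ∀ α ∈ S, negRoot α ∉ S)
    (hadd : ∀ α ∈ S, ∀ β ∈ S, ∀ γ : H.root,
      (γ.1 : H → ℂ) = (α.1 : H → ℂ) + (β.1 : H → ℂ) → γ ∈ S) {x y : L}
    (hx : x ∈ rootSpaces S) (hy : y ∈ rootSpaces S) : ⁅x, y⁆ ∈ rootSpaces S := by
  have h1 : ∀ α ∈ S, ∀ x ∈ rootSpace H (α.1 : H → ℂ), ∀ y ∈ rootSpaces S,
      ⁅x, y⁆ ∈ rootSpaces S := by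
    intro α hα x hx y hy
    have : rootSpaces S ≤ (rootSpaces S).comap (LieAlgebra.ad ℂ L x : L →ₗ[ℂ] L) :=
      rootSpaces_le fun β hβ y hy => by
        rw [Submodule.mem_comap, LieAlgebra.ad_apply]
        have hxy := lie_mem_rootSpace hx hy
        have hne : (α.1 : H → ℂ) + (β.1 : H → ℂ) ≠ 0 := fun e => hneg α hα <| by
          have : β = negRoot α := root_ext (by
            rw [coe_negRoot]; exact (neg_eq_of_add_eq_zero_right e).symm)
          exact this ▸ hβ
        rcases eq_zero_or_exists_root hxy hne with h0 | ⟨γ, hγ⟩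
        · rw [h0]
          exact zero_mem _
        · exact mem_rootSpaces (hadd α hα β hβ γ hγ) (hγ ▸ hxy)
    exact this hy
  have : rootSpaces S ≤ (rootSpaces S).comap ((LieAlgebra.ad ℂ L y : L →ₗ[ℂ] L)) :=
    rootSpaces_le fun α hα x hx => by
      rw [Submodule.mem_comap, LieAlgebra.ad_apply, ← lie_skew]
      exact neg_mem (h1 α hα x hx y hy)
  rw [← lie_skew]
  exact neg_mem (this hx)

end Coisotropic

namespace Coisotropic

/-! ### Contraction of tensors with Killing functionals -/

section Tensor

variable {L : Type*} [LieRing L] [LieAlgebra ℂ L]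

/-- The contraction `r ↦ r^♯ ξ`, as a linear map in `r`. -/
def contraction (ξ : Module.Dual ℂ L) : L ⊗[ℂ] L →ₗ[ℂ] L :=
  (TensorProduct.lid ℂ L).toLinearMap ∘ₗ LinearMap.rTensor L ξ

lemma sharp_apply (r : L ⊗[ℂ] L) (ξ : Module.Dual ℂ L) : sharp r ξ = contraction ξ r := rfl

lemma contraction_tmul (ξ : Module.Dual ℂ L) (x y : L) : contraction ξ (x ⊗ₜ y) = ξ x • y := by
  simp [contraction]

/-- Invariance of K moves ad x from the contracted tensor factor to y, with a sign. Thus [x, r]^♯ is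
the commutator of ad x and r^♯. -/
lemma contraction_lie (x y : L) (r : L ⊗[ℂ] L) :
    contraction (killingForm ℂ L y) ⁅x, r⁆ =
      ⁅x, contraction (killingForm ℂ L y) r⁆ - contraction (killingForm ℂ L ⁅x, y⁆) r := by
  induction r with
  | zero => simp
  | add r s hr hs => rw [lie_add, map_add, map_add, map_add, lie_add, hr, hs]; abel
  | tmul u v =>
    rw [TensorProduct.LieModule.lie_tmul_right, map_add, contraction_tmul, contraction_tmul,
      contraction_tmul, contraction_tmul, killingForm_lie_left, lie_smul, neg_smul]
    abel

end Tensor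

variable {L : Type*} [LieRing L] [LieAlgebra ℂ L] [FiniteDimensional ℂ L] [IsKilling ℂ L]
variable {H : LieSubalgebra ℂ L} [H.IsCartanSubalgebra]
variable {b : (rootSystem H).Base} {E : H.root → L}

/-! ### Root vectors and their 𝔰𝔩₂-triples -/

namespace IsChevalley

variable (hE : IsChevalley E)
include hE

lemma lie_neg_ne_zero (α : H.root) : ⁅E α, E (negRoot α)⁆ ≠ 0 := by
  rw [hE.lie_neg]
  have h : (coroot α.1 : H) ≠ 0 := fun h =>
    LieSubalgebra.isNonZero_coe_root α (coroot_eq_zero_iff.mp h)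
  exact_mod_cast h

lemma ne_zero (α : H.root) : E α ≠ 0 := fun h =>
  hE.lie_neg_ne_zero α (by rw [h, zero_lie])

lemma killingForm_neg_ne_zero (α : H.root) : killingForm ℂ L (E α) (E (negRoot α)) ≠ 0 := by
  intro h
  have h1 := lie_eq_killingForm_smul_of_mem_rootSpace_of_mem_rootSpace_neg (hE.mem_rootSpace α)
    (hE.mem_rootSpace (negRoot α))
  rw [h, zero_smul] at h1
  exact hE.lie_neg_ne_zero α h1

lemma cartan_lie {h : H} (α : H.root) : ⁅(h : L), E α⁆ = α.1 h • E α :=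
  lie_eq_smul_of_mem_rootSpace (hE.mem_rootSpace α) h

lemma isSl2Triple (α : H.root) :
    IsSl2Triple ((coroot α.1 : H) : L) (E α) (E (negRoot α)) where
  h_ne_zero := by
    rw [← hE.lie_neg]
    exact hE.lie_neg_ne_zero α
  lie_e_f := hE.lie_neg α
  lie_h_e_nsmul := by
    rw [hE.cartan_lie, apply_coroot_self, two_smul, two_nsmul]
  lie_h_f_nsmul := by
    have h : (negRoot α).1 (coroot α.1) = -α.1 (coroot α.1) := rfl
    rw [hE.cartan_lie, h, apply_coroot_self, neg_smul, two_smul, two_nsmul]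

/-- If `γ(H_δ) = -1`, then `E_γ` is not annihilated by `E_δ`. -/
lemma lie_ne_zero {δ γ : H.root} (h : γ.1 (coroot δ.1) = -1) : ⁅E δ, E γ⁆ ≠ 0 := by
  intro h0
  -- Otherwise E_γ would be a primitive vector of weight -1, but in finite dimension such weights
  -- are natural numbers.
  have hp : (hE.isSl2Triple δ).HasPrimitiveVectorWith (E γ) (-1 : ℂ) :=
    ⟨hE.ne_zero γ, by rw [hE.cartan_lie, h], h0⟩
  obtain ⟨n, hn⟩ := hp.exists_nat
  have h1 : ((n + 1 : ℕ) : ℂ) = 0 := by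
    push_cast
    rw [← hn]
    norm_num
  exact Nat.cast_ne_zero.mpr n.succ_ne_zero h1

end IsChevalley

/-! ### The operator π^♯ and the signs of roots -/

variable (b) in
open Classical in
/-- The sign of a root: `1` on positive and `-1` on negative roots. -/
def rootSign (α : H.root) : ℂ := if α ∈ posRoots b then 1 else -1

lemma rootSign_eq_iff {α β : H.root} :
    rootSign b α = rootSign b β ↔ (α ∈ posRoots b ↔ β ∈ posRoots b) := by
  unfold rootSign
  by_cases hα : α ∈ posRoots b <;> by_cases hβ : β ∈ posRoots b <;> simp [hα, hβ] <;> norm_num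

lemma rootSign_ne_zero (α : H.root) : rootSign b α ≠ 0 := by
  unfold rootSign
  split_ifs <;> norm_num

lemma contraction_wedge (y u v : L) :
    contraction (killingForm ℂ L y) (wedge u v) =
      killingForm ℂ L y u • v - killingForm ℂ L y v • u := by
  rw [wedge, map_sub, contraction_tmul, contraction_tmul]

lemma contraction_bivector_cartan (hE : IsChevalley E) {h : L} (hh : h ∈ H) :
    contraction (killingForm ℂ L h) (bivector b E) = 0 := by
  rw [bivector, map_sum]
  refine Finset.sum_eq_zero fun α _ => ?_
  rw [map_smul, contraction_wedge, killingForm_cartan_rootSpace hh (hE.mem_rootSpace α),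
    killingForm_cartan_rootSpace hh (hE.mem_rootSpace _)]
  simp

/-- Under the identification `𝔤* = 𝔤` by the Killing form, `π^♯` is `-1` on `𝔫` and `1` on `𝔫₋`. -/
lemma contraction_bivector_rootSpace (hE : IsChevalley E) {γ : H.root} {x : L}
    (hx : x ∈ rootSpace H (γ.1 : H → ℂ)) :
    contraction (killingForm ℂ L x) (bivector b E) = -rootSign b γ • x := by
  classical
  obtain ⟨a, rfl⟩ := exists_smul_eq_of_mem_rootSpace (hE.mem_rootSpace γ) (hE.ne_zero γ) hx
  -- `sharp` is linear in the functional, which lets the scalar a come out.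
  rw [← sharp_apply, map_smul, map_smul, sharp_apply, smul_comm]
  congr 1
  have hzero : ∀ α : H.root, α ≠ γ → killingForm ℂ L (E γ) (E (negRoot α)) = 0 := fun α hα =>
    killingForm_rootSpace_rootSpace (hE.mem_rootSpace γ) (hE.mem_rootSpace _)
      fun h => hα (negRoot_injective h)
  have hzero' : ∀ α : H.root, α ≠ negRoot γ → killingForm ℂ L (E γ) (E α) = 0 := fun α hα =>
    killingForm_rootSpace_rootSpace (hE.mem_rootSpace γ) (hE.mem_rootSpace _) hα
  have hK := hE.killingForm_neg_ne_zero γ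
  rw [bivector, map_sum]
  -- E_γ pairs only with 𝔤_{-γ}, so a single summand of π survives: α = γ for positive γ, and α = -γ
  -- otherwise. The order of the wedge produces the sign.
  by_cases hγ : γ ∈ posRoots b
  · rw [Finset.sum_eq_single γ]
    · rw [map_smul, contraction_wedge, hzero' γ (negRoot_ne_self γ).symm, rootSign, if_pos hγ]
      rw [zero_smul, zero_sub, smul_neg, smul_smul, one_div_mul_cancel hK, neg_smul]
    · intro α hα hne
      have hα' : α ∈ posRoots b := (Finset.mem_filter.mp hα).2
      have hne' : α ≠ negRoot γ := by
        rintro rfl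
        exact (negRoot_mem_posRoots_iff b γ).mp hα' hγ
      rw [map_smul, contraction_wedge, hzero α hne, hzero' α hne']
      simp
    · intro h
      exact absurd (Finset.mem_filter.mpr ⟨Finset.mem_univ _, hγ⟩) h
  · have hγ' := (negRoot_mem_posRoots_iff b γ).mpr hγ
    rw [Finset.sum_eq_single (negRoot γ)]
    · rw [map_smul, contraction_wedge, hzero (negRoot γ) (negRoot_ne_self γ), rootSign, if_neg hγ, negRoot_negRoot,
        killingForm_comm (E (negRoot γ))]
      rw [zero_smul, sub_zero, smul_smul, one_div_mul_cancel hK, neg_neg]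
    · intro α hα hne
      have hα' : α ∈ posRoots b := (Finset.mem_filter.mp hα).2
      have hne' : α ≠ γ := by
        rintro rfl
        exact hγ hα'
      rw [map_smul, contraction_wedge, hzero α hne', hzero' α hne]
      simp
    · intro h
      exact absurd (Finset.mem_filter.mpr ⟨Finset.mem_univ _, hγ'⟩) h

/-! ### The commutator of ad E_δ with π^♯ -/

variable (b E) in
/-- The endomorphism `y ↦ [E_δ, π]^♯ K(y, ·)` of `𝔤`. -/
def adBivector (δ : H.root) : L →ₗ[ℂ] L := sharp ⁅E δ, bivector b E⁆ ∘ₗ killingForm ℂ L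

lemma range_adBivector (δ : H.root) : LinearMap.range (adBivector b E δ) = zambon b E δ := by
  refine LinearMap.range_comp_of_range_eq_top _ (LinearMap.range_eq_top.mpr ?_)
  have hinj : Function.Injective (killingForm ℂ L) :=
    LinearMap.ker_eq_bot.mp (IsKilling.ker_killingForm_eq_bot ℂ L)
  exact (LinearMap.injective_iff_surjective_of_finrank_eq_finrank
    (Subspace.dual_finrank_eq (K := ℂ) (V := L)).symm).mp hinj

lemma adBivector_apply (δ : H.root) (y : L) :
    adBivector b E δ y = ⁅E δ, contraction (killingForm ℂ L y) (bivector b E)⁆ -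
      contraction (killingForm ℂ L ⁅E δ, y⁆) (bivector b E) :=
  contraction_lie _ _ _

lemma adBivector_cartan (hE : IsChevalley E) (δ : H.root) (h : H) :
    adBivector b E δ h = -(rootSign b δ * δ.1 h) • E δ := by
  have h1 : ⁅E δ, (h : L)⁆ = -(δ.1 h • E δ) := by rw [← lie_skew, hE.cartan_lie]
  rw [adBivector_apply, contraction_bivector_cartan hE h.2, lie_zero, h1,
    contraction_bivector_rootSpace hE
      (neg_mem (SMulMemClass.smul_mem _ (hE.mem_rootSpace δ)))]
  module

lemma adBivector_root_neg (hE : IsChevalley E) (δ : H.root) :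
    adBivector b E δ (E (negRoot δ)) = rootSign b δ • ((coroot δ.1 : H) : L) := by
  have h1 : rootSign b (negRoot δ) = -rootSign b δ := by
    have := negRoot_mem_posRoots_iff b δ
    unfold rootSign
    by_cases h : δ ∈ posRoots b <;> simp [h, this]
  rw [adBivector_apply, contraction_bivector_rootSpace hE (hE.mem_rootSpace _), lie_smul,
    hE.lie_neg, contraction_bivector_cartan hE (SetLike.coe_mem _), h1]
  module

/-- Both terms of the commutator are multiples of [E_δ, E_γ], with coefficients the signs of γ and
of ε = δ + γ. Only a sign change between the two contributes to the image. -/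
lemma adBivector_root_add (hE : IsChevalley E) {δ γ ε : H.root}
    (h : (ε.1 : H → ℂ) = (δ.1 : H → ℂ) + (γ.1 : H → ℂ)) :
    adBivector b E δ (E γ) = (rootSign b ε - rootSign b γ) • ⁅E δ, E γ⁆ := by
  rw [adBivector_apply, contraction_bivector_rootSpace hE (hE.mem_rootSpace _), lie_smul,
    contraction_bivector_rootSpace (γ := ε) hE
      (h ▸ lie_mem_rootSpace (hE.mem_rootSpace δ) (hE.mem_rootSpace γ))]
  module

/-! ### The image of [E_δ, π]^♯ when the Cartan integers are bounded by 1 -/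

variable (b) in
/-- The roots of the same sign as `δ` whose sign is changed by `s_δ`. -/
def signChanges (δ : H.root) : Set H.root :=
  {γ | (γ ∈ posRoots b ↔ δ ∈ posRoots b) ∧ (reflectionOf δ • γ ∈ posRoots b ↔ δ ∉ posRoots b)}

lemma reflectionOf_smul_self (δ : H.root) : reflectionOf δ • δ = negRoot δ := by
  apply root_ext
  rw [coe_reflectionOf_smul, apply_coroot_self, coe_negRoot, two_smul]
  abel

lemma self_mem_signChanges (δ : H.root) : δ ∈ signChanges b δ := by
  refine ⟨Iff.rfl, ?_⟩
  rw [reflectionOf_smul_self, negRoot_mem_posRoots_iff]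

variable {δ : H.root} (hδ : ∀ γ : H.root, γ ≠ δ → γ ≠ negRoot δ →
  γ.1 (coroot δ.1) = -1 ∨ γ.1 (coroot δ.1) = 0 ∨ γ.1 (coroot δ.1) = 1)
include hδ

/-- A sign change from γ to δ + γ forces δ and γ to have opposite signs, so ε has the sign of δ.
Since ε(H_δ) = γ(H_δ) + 2, the bound on Cartan integers leaves only ε(H_δ) = 1, and then s_δ ε = ε -
δ = γ. -/
lemma mem_signChanges_of_add {γ ε : H.root} (h : (ε.1 : H → ℂ) = (δ.1 : H → ℂ) + (γ.1 : H → ℂ))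
    (hs : rootSign b ε ≠ rootSign b γ) : ε ∈ signChanges b δ := by
  rw [Ne, rootSign_eq_iff] at hs
  have h1 : ε ∈ posRoots b ↔ δ ∈ posRoots b := by
    have p1 := fun hδ hγ => add_mem_posRoots (b := b) (α := δ) (β := γ) hδ hγ h
    have p2 := fun hδ hγ => add_notMem_posRoots (b := b) (α := δ) (β := γ) hδ hγ h
    tauto
  have happ : ε.1 (coroot δ.1) = 2 + γ.1 (coroot δ.1) := by
    have := congrFun h (coroot δ.1)
    rwa [Pi.add_apply, apply_coroot_self] at this
  -- The bound applies only away from ±δ. Here ε = δ or γ = -δ would make the other root zero; ε =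
  -- -δ and γ = δ are ruled out by signs.
  have hεδ : ε ≠ δ := by
    rintro rfl
    simp at h
  have hεδ' : ε ≠ negRoot δ := by
    rintro rfl
    rw [negRoot_mem_posRoots_iff] at h1
    tauto
  have hγδ : γ ≠ δ := by
    rintro rfl
    tauto
  have hγδ' : γ ≠ negRoot δ := by
    rintro rfl
    simp at h
  have hε1 : ε.1 (coroot δ.1) = 1 := by
    rcases hδ ε hεδ hεδ' with h2 | h2 | h2 <;> rcases hδ γ hγδ hγδ' with h3 | h3 | h3 <;>
      rw [h2, h3] at happ <;> norm_num at happ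
    exact h2
  have hrefl : reflectionOf δ • ε = γ := by
    apply root_ext
    rw [coe_reflectionOf_smul, hε1, one_smul, h]
    abel
  refine ⟨h1, ?_⟩
  rw [hrefl]
  tauto

/-- `[E_δ, π]^♯ 𝔤*` for a root `δ` whose Cartan integers with other roots are at most `1`. -/
lemma zambon_eq (hE : IsChevalley E) :
    zambon b E δ = (corootLine δ).map H.toSubmodule.subtype ⊔ rootSpaces (signChanges b δ) := by
  have hline : ((coroot δ.1 : H) : L) ∈ (corootLine δ).map H.toSubmodule.subtype :=
    ⟨coroot δ.1, Submodule.mem_span_singleton_self _, rfl⟩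
  rw [← range_adBivector]
  set R := (corootLine δ).map H.toSubmodule.subtype ⊔ rootSpaces (signChanges b δ)
  apply le_antisymm
  · rw [LinearMap.range_eq_map, ← cartan_sup_rootSpaces_univ H, Submodule.map_le_iff_le_comap]
    refine sup_le (fun h hh => ?_) (rootSpaces_le fun γ _ x hx => ?_)
    · rw [Submodule.mem_comap, adBivector_cartan hE δ ⟨h, hh⟩]
      exact Submodule.smul_mem _ _ (Submodule.mem_sup_right
        (mem_rootSpaces (self_mem_signChanges δ) (hE.mem_rootSpace δ)))
    · obtain ⟨a, rfl⟩ := exists_smul_eq_of_mem_rootSpace (hE.mem_rootSpace γ) (hE.ne_zero γ) hx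
      refine Submodule.smul_mem _ _ ?_
      rw [Submodule.mem_comap]
      by_cases hneg : γ = negRoot δ
      · rw [hneg, adBivector_root_neg hE]
        exact Submodule.smul_mem _ _ (Submodule.mem_sup_left hline)
      have hmem := lie_mem_rootSpace (hE.mem_rootSpace δ) (hE.mem_rootSpace γ)
      rcases eq_zero_or_exists_root hmem
        (fun e => hneg (root_ext (neg_eq_of_add_eq_zero_right e).symm)) with h0 | ⟨ε, hε⟩
      · rw [adBivector_apply, contraction_bivector_rootSpace hE (hE.mem_rootSpace γ), lie_smul,
          h0, smul_zero, map_zero, ← sharp_apply, map_zero, sub_zero]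
        exact zero_mem _
      · rw [adBivector_root_add hE hε]
        by_cases hs : rootSign b ε = rootSign b γ
        · rw [hs, sub_self, zero_smul]
          exact zero_mem _
        · exact Submodule.smul_mem _ _ (Submodule.mem_sup_right
            (mem_rootSpaces (mem_signChanges_of_add hδ hε hs) (hε ▸ hmem)))
  -- Preimages up to non-zero scalars: E_{-δ} for H_δ, H_δ for E_δ, and E_γ with γ = s_δ ε for every
  -- other ε.
  · have hmem : ∀ {a : ℂ} {x : L}, a ≠ 0 → a • x ∈ LinearMap.range (adBivector b E δ) →
        x ∈ LinearMap.range (adBivector b E δ) := fun ha hx =>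
      (Submodule.smul_mem_iff _ ha).mp hx
    refine sup_le ?_ (rootSpaces_le fun ε hε x hx => ?_)
    · rw [Submodule.map_le_iff_le_comap, corootLine, Submodule.span_singleton_le_iff_mem]
      exact hmem (rootSign_ne_zero (b := b) δ) ⟨_, adBivector_root_neg hE δ⟩
    · by_cases hεδ : ε = δ
      · subst hεδ
        obtain ⟨a, rfl⟩ := exists_smul_eq_of_mem_rootSpace (hE.mem_rootSpace ε) (hE.ne_zero ε) hx
        refine Submodule.smul_mem _ _ (hmem (a := -(rootSign b ε * 2)) ?_
          ⟨(coroot ε.1 : H), by rw [adBivector_cartan hE, apply_coroot_self]⟩)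
        simpa using rootSign_ne_zero ε
      obtain ⟨h1, h2⟩ := hε
      have hεδ' : ε ≠ negRoot δ := by
        rintro rfl
        rw [negRoot_mem_posRoots_iff] at h1
        tauto
      set γ := reflectionOf δ • ε with hγ
      have hcoe := coe_reflectionOf_smul δ ε
      rw [← hγ] at hcoe
      -- With value -1, γ = ε + δ would keep the common sign of ε and δ; with value 0, γ = ε.
      -- Neither changes the sign.
      have hε1 : ε.1 (coroot δ.1) = 1 := by
        rcases hδ ε hεδ hεδ' with h | h | h
        · have h3 : (γ.1 : H → ℂ) = (ε.1 : H → ℂ) + (δ.1 : H → ℂ) := by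
            rw [hcoe, h, neg_smul, one_smul, sub_neg_eq_add]
          have p1 := fun hε hδ => add_mem_posRoots (b := b) (α := ε) (β := δ) hε hδ h3
          have p2 := fun hε hδ => add_notMem_posRoots (b := b) (α := ε) (β := δ) hε hδ h3
          tauto
        · have h3 : γ = ε := root_ext (by rw [hcoe, h, zero_smul, sub_zero])
          rw [h3] at h2
          tauto
        · exact h
      rw [hε1, one_smul] at hcoe
      have hadd : (ε.1 : H → ℂ) = (δ.1 : H → ℂ) + (γ.1 : H → ℂ) := by
        rw [hcoe]
        abel
      have hγ1 : γ.1 (coroot δ.1) = -1 := by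
        have := congrFun hcoe (coroot δ.1)
        rw [Pi.sub_apply, hε1, apply_coroot_self] at this
        rw [this]
        norm_num
      -- Since γ(H_δ) = -1, the bracket [E_δ, E_γ] is non-zero and spans the line 𝔤_ε.
      obtain ⟨a, rfl⟩ := exists_smul_eq_of_mem_rootSpace (α := ε)
        (hadd ▸ lie_mem_rootSpace (hE.mem_rootSpace δ) (hE.mem_rootSpace γ))
        (hE.lie_ne_zero hγ1) hx
      refine Submodule.smul_mem _ _ (hmem (a := rootSign b ε - rootSign b γ) ?_
        ⟨E γ, adBivector_root_add hE hadd⟩)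
      rw [sub_ne_zero, Ne, rootSign_eq_iff]
      tauto

end Coisotropic

namespace Coisotropic

/-! ### The form on 𝔤 ⊕ 𝔤 and orthogonality in 𝔥 -/

section General

variable {L : Type*} [LieRing L] [LieAlgebra ℂ L]

lemma doubleForm_apply (c : ℂ) (p q : L × L) :
    doubleForm L c p q = c * (killingForm ℂ L p.1 q.1 - killingForm ℂ L p.2 q.2) := by
  simp [doubleForm, scaledKilling, mul_sub]

lemma mem_diag {U : Submodule ℂ L} {p : L × L} : p ∈ diag U ↔ p.1 ∈ U ∧ p.2 = p.1 := by
  constructor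
  · rintro ⟨x, hx, rfl⟩
    exact ⟨hx, rfl⟩
  · rintro ⟨h1, h2⟩
    exact ⟨p.1, h1, Prod.ext rfl h2.symm⟩

lemma mem_antidiag {U : Submodule ℂ L} {p : L × L} : p ∈ antidiag U ↔ p.1 ∈ U ∧ p.2 = -p.1 := by
  constructor
  · rintro ⟨x, hx, rfl⟩
    exact ⟨hx, rfl⟩
  · rintro ⟨h1, h2⟩
    exact ⟨p.1, h1, Prod.ext rfl h2.symm⟩

end General

variable {L : Type*} [LieRing L] [LieAlgebra ℂ L] [FiniteDimensional ℂ L] [IsKilling ℂ L]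
variable {H : LieSubalgebra ℂ L} [H.IsCartanSubalgebra]
variable {b : (rootSystem H).Base} {c : ℂ}

lemma mem_cartanPerp (hc : c ≠ 0) {V : Submodule ℂ H} {d : H} :
    d ∈ cartanPerp c V ↔ ∀ v ∈ V, killingForm ℂ L (v : L) d = 0 := by
  have h : ∀ v : H, (scaledKilling L c).restrict H.toSubmodule v d =
    c * killingForm ℂ L (v : L) d := fun v => rfl
  simp only [cartanPerp, LinearMap.BilinForm.mem_orthogonal_iff, h, mul_eq_zero, hc,
    false_or]

/-- K is nondegenerate on 𝔥, because 𝔥 is orthogonal to every root space. -/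
lemma cartanPerp_cartanPerp (hc : c ≠ 0) (V : Submodule ℂ H) :
    cartanPerp c (cartanPerp c V) = V := by
  have hsymm : ∀ x y : H, (scaledKilling L c).restrict H.toSubmodule x y =
      (scaledKilling L c).restrict H.toSubmodule y x := fun x y =>
    congrArg (c * ·) (killingForm_comm (x : L) y)
  have hrefl : ((scaledKilling L c).restrict H.toSubmodule).IsRefl := fun x y h => by
    rw [hsymm, h]
  refine LinearMap.BilinForm.orthogonal_orthogonal ?_ hrefl V
  refine hrefl.nondegenerate_iff_separatingLeft.mpr fun x hx => ?_
  have h0 : (x : L) = 0 := by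
    refine eq_zero_of_killingForm_cartan_rootSpace (H := H) (fun y hy => ?_)
      fun α y hy => killingForm_cartan_rootSpace x.2 hy
    have := hx ⟨y, hy⟩
    exact (mul_eq_zero.mp (show c * killingForm ℂ L (x : L) y = 0 from this)).resolve_left hc
  exact_mod_cast h0

/-! ### The subspaces `𝔩_{V,u,v}` -/

lemma mem_lagr {V : Submodule ℂ H} {u v : (rootSystem H).weylGroup} {p : L × L} :
    p ∈ lagr c b V u v ↔ ∃ x ∈ V, ∃ d ∈ cartanPerp c V, ∃ n ∈ posNilp b u, ∃ m ∈ negNilp b v,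
      p = ((x : L) + d + n, (x : L) - d + m) := by
  constructor
  · intro hp
    obtain ⟨p1, hp1, q, hq, rfl⟩ := Submodule.mem_sup.mp hp
    obtain ⟨p2, hp2, r, hr, rfl⟩ := Submodule.mem_sup.mp hp1
    obtain ⟨p3, hp3, s, hs, rfl⟩ := Submodule.mem_sup.mp hp2
    obtain ⟨_, ⟨x, hx, rfl⟩, rfl⟩ := hp3
    obtain ⟨_, ⟨d, hd, rfl⟩, rfl⟩ := hs
    obtain ⟨hr1, hr2⟩ := Submodule.mem_prod.mp hr
    obtain ⟨hq1, hq2⟩ := Submodule.mem_prod.mp hq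
    rw [Submodule.mem_bot] at hr2 hq1
    refine ⟨x, hx, d, hd, r.1, hr1, q.2, hq2, Prod.ext ?_ ?_⟩
    · simp [hq1]
    · simp [hr2, sub_eq_add_neg]
  · rintro ⟨x, hx, d, hd, n, hn, m, hm, rfl⟩
    have h1 : ((x : L), (x : L)) ∈ diag (V.map H.toSubmodule.subtype) :=
      mem_diag.mpr ⟨⟨x, hx, rfl⟩, rfl⟩
    have h2 : ((d : L), -(d : L)) ∈ antidiag ((cartanPerp c V).map H.toSubmodule.subtype) :=
      mem_antidiag.mpr ⟨⟨d, hd, rfl⟩, rfl⟩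
    have h3 : (n, (0 : L)) ∈ (posNilp b u).prod (⊥ : Submodule ℂ L) :=
      ⟨hn, Submodule.zero_mem _⟩
    have h4 : ((0 : L), m) ∈ (⊥ : Submodule ℂ L).prod (negNilp b v) :=
      ⟨Submodule.zero_mem _, hm⟩
    have := Submodule.add_mem_sup (Submodule.add_mem_sup (Submodule.add_mem_sup h1 h2) h3) h4
    convert! this using 1
    ext <;> simp [sub_eq_add_neg]

variable (b) in
/-- `𝔤*` is `𝔩_{0,e,e}`. -/
lemma stdDual_eq_lagr (hc : c ≠ 0) : stdDual b = lagr c b ⊥ 1 1 := by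
  have h1 : diag ((⊥ : Submodule ℂ H).map H.toSubmodule.subtype) = ⊥ := by
    rw [Submodule.map_bot, diag, Submodule.map_bot]
  have h2 : cartanPerp c (⊥ : Submodule ℂ H) = ⊤ := by
    refine eq_top_iff.mpr fun d _ => (mem_cartanPerp hc).mpr fun v hv => ?_
    rw [(Submodule.mem_bot ℂ).mp hv]
    simp
  rw [lagr, h1, h2, bot_sup_eq, Submodule.map_subtype_top]
  rfl

lemma mem_stdDual {p : L × L} : p ∈ stdDual b ↔
    ∃ h ∈ H, ∃ n ∈ posNilp b 1, ∃ m ∈ negNilp b 1, p = (h + n, -h + m) := by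
  -- 𝔤* does not depend on the scalar c, so c = 1 serves.
  rw [stdDual_eq_lagr b one_ne_zero, mem_lagr]
  constructor
  · rintro ⟨x, hx, d, -, n, hn, m, hm, rfl⟩
    rw [Submodule.mem_bot] at hx
    subst hx
    exact ⟨d, d.2, n, hn, m, hm, by simp⟩
  · rintro ⟨h, hh, n, hn, m, hm, rfl⟩
    refine ⟨0, Submodule.zero_mem _, ⟨h, hh⟩, ?_, n, hn, m, hm, by simp⟩
    refine (mem_cartanPerp one_ne_zero).mpr fun v hv => ?_
    rw [(Submodule.mem_bot ℂ).mp hv]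
    simp

lemma lie_mem_rootSpaces_of_cartan_add {S : Set H.root} (hneg : ∀ α ∈ S, negRoot α ∉ S)
    (hadd : ∀ α ∈ S, ∀ β ∈ S, ∀ γ : H.root,
      (γ.1 : H → ℂ) = (α.1 : H → ℂ) + (β.1 : H → ℂ) → γ ∈ S) {h k n m : L}
    (hh : h ∈ H) (hk : k ∈ H) (hn : n ∈ rootSpaces S) (hm : m ∈ rootSpaces S) :
    ⁅h + n, k + m⁆ ∈ rootSpaces S := by
  have h0 : ⁅h, k⁆ = 0 := by
    have : ⁅(⟨h, hh⟩ : H), (⟨k, hk⟩ : H)⁆ = 0 := trivial_lie_zero _ _ _ _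
    exact congrArg Subtype.val this
  rw [add_lie, lie_add, lie_add, h0, zero_add, ← lie_skew n k]
  exact add_mem (cartan_lie_mem_rootSpaces hh hm)
    (add_mem (neg_mem (cartan_lie_mem_rootSpaces hk hn)) (lie_mem_rootSpaces hneg hadd hn hm))

lemma killingForm_cartan_add {S : Set H.root} (hneg : ∀ α ∈ S, negRoot α ∉ S) {h k n m : L}
    (hh : h ∈ H) (hk : k ∈ H) (hn : n ∈ rootSpaces S) (hm : m ∈ rootSpaces S) :
    killingForm ℂ L (h + n) (k + m) = killingForm ℂ L h k := by
  rw [map_add, map_add, LinearMap.add_apply, LinearMap.add_apply,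
    killingForm_cartan_rootSpaces hh hm, killingForm_comm n k, killingForm_cartan_rootSpaces hk hn,
    killingForm_rootSpaces_rootSpaces hneg hn hm]
  ring

lemma negRoot_mem_smul_posRoots_iff (u : (rootSystem H).weylGroup) (α : H.root) :
    negRoot α ∈ (fun γ => u • γ) '' posRoots b ↔ α ∉ (fun γ => u • γ) '' posRoots b := by
  rw [mem_smul_posRoots_iff, mem_smul_posRoots_iff, smul_negRoot, negRoot_mem_posRoots_iff]

lemma negRoot_mem_smul_negRoots_iff (u : (rootSystem H).weylGroup) (α : H.root) :
    negRoot α ∈ (fun γ => u • γ) '' negRoots b ↔ α ∉ (fun γ => u • γ) '' negRoots b := by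
  rw [mem_smul_negRoots_iff, mem_smul_negRoots_iff, smul_negRoot, negRoot_mem_posRoots_iff]

/-- As 𝔥 is abelian, brackets fall into (u·𝔫, 0) + (0, v·𝔫₋): the sets uΦ⁺ and vΦ⁻ are closed under
addition of roots and contain no opposite pairs. -/
lemma isLieClosed_lagr (V : Submodule ℂ H) (u v : (rootSystem H).weylGroup) :
    IsLieClosed (lagr c b V u v) := by
  intro p hp q hq
  obtain ⟨x, -, d, -, n, hn, m, hm, rfl⟩ := mem_lagr.mp hp
  obtain ⟨x', -, d', -, n', hn', m', hm', rfl⟩ := mem_lagr.mp hq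
  refine mem_lagr.mpr ⟨0, zero_mem _, 0, zero_mem _,
    ⁅(x : L) + d + n, (x' : L) + d' + n'⁆, ?_, ⁅(x : L) - d + m, (x' : L) - d' + m'⁆, ?_, ?_⟩
  · refine lie_mem_rootSpaces_of_cartan_add (H := H)
      (fun α hα h => (negRoot_mem_smul_posRoots_iff u α).mp h hα) ?_
      (x + d).2 (x' + d').2 hn hn'
    intro α hα β hβ γ hγ
    rw [mem_smul_posRoots_iff] at hα hβ ⊢
    exact add_mem_posRoots hα hβ (coe_smul_eq_add _ hγ)
  · refine lie_mem_rootSpaces_of_cartan_add (H := H)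
      (fun α hα h => (negRoot_mem_smul_negRoots_iff v α).mp h hα) ?_
      (x - d).2 (x' - d').2 hm hm'
    intro α hα β hβ γ hγ
    rw [mem_smul_negRoots_iff] at hα hβ ⊢
    exact add_notMem_posRoots hα hβ (coe_smul_eq_add _ hγ)
  · simp

lemma isotropic_lagr (hc : c ≠ 0) (V : Submodule ℂ H) (u v : (rootSystem H).weylGroup)
    {p q : L × L} (hp : p ∈ lagr c b V u v) (hq : q ∈ lagr c b V u v) :
    doubleForm L c p q = 0 := by
  obtain ⟨x, hx, d, hd, n, hn, m, hm, rfl⟩ := mem_lagr.mp hp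
  obtain ⟨x', hx', d', hd', n', hn', m', hm', rfl⟩ := mem_lagr.mp hq
  have h1 := killingForm_cartan_add (H := H)
    (fun α hα h => (negRoot_mem_smul_posRoots_iff u α).mp h hα) (x + d).2 (x' + d').2 hn hn'
  have h2 := killingForm_cartan_add (H := H)
    (fun α hα h => (negRoot_mem_smul_negRoots_iff v α).mp h hα) (x - d).2 (x' - d').2 hm hm'
  push_cast at h1 h2
  rw [doubleForm_apply, h1, h2]
  -- What remains is K(x+d, x'+d') - K(x-d, x'-d') = 2K(x, d') + 2K(d, x').
  have h3 := (mem_cartanPerp hc).mp hd' x hx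
  have h4 := (mem_cartanPerp hc).mp hd x' hx'
  rw [killingForm_comm] at h4
  simp only [map_add, map_sub, LinearMap.add_apply, LinearMap.sub_apply, h3, h4]
  ring

lemma mem_lagr_of_orthogonal (hc : c ≠ 0) (V : Submodule ℂ H) (u v : (rootSystem H).weylGroup)
    {p : L × L} (hp : ∀ q ∈ lagr c b V u v, doubleForm L c q p = 0) : p ∈ lagr c b V u v := by
  have hp' : ∀ q ∈ lagr c b V u v, killingForm ℂ L q.1 p.1 = killingForm ℂ L q.2 p.2 :=
    fun q hq => by
      have := hp q hq
      rw [doubleForm_apply] at this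
      exact sub_eq_zero.mp ((mul_eq_zero.mp this).resolve_left hc)
  -- Testing against (u·𝔫, 0) confines the roots of the first component to uΦ⁺; (0, v·𝔫₋) does the
  -- same for the second with vΦ⁻.
  obtain ⟨k, hk, n, hn, h1⟩ := exists_cartan_add_of_orthogonal
      (S := (fun γ => u • γ) '' posRoots b) (x := p.1) fun α hα y hy => by
    rw [← negRoot_mem_smul_posRoots_iff] at hα
    have := hp' (y, 0) (mem_lagr.mpr ⟨0, zero_mem _, 0, zero_mem _, y, mem_rootSpaces hα hy,
      0, zero_mem _, by simp⟩)
    rw [killingForm_comm, this]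
    simp
  obtain ⟨l, hl, m, hm, h2⟩ := exists_cartan_add_of_orthogonal
      (S := (fun γ => v • γ) '' negRoots b) (x := p.2) fun α hα y hy => by
    rw [← negRoot_mem_smul_negRoots_iff] at hα
    have := hp' (0, y) (mem_lagr.mpr ⟨0, zero_mem _, 0, zero_mem _, 0, zero_mem _, y,
      mem_rootSpaces hα hy, by simp⟩)
    rw [killingForm_comm, ← this]
    simp
  have hK1 : ∀ h : H, killingForm ℂ L (h : L) p.1 = killingForm ℂ L (h : L) k := fun h => by
    rw [← h1, map_add, killingForm_cartan_rootSpaces h.2 hn, add_zero]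
  have hK2 : ∀ h : H, killingForm ℂ L (h : L) p.2 = killingForm ℂ L (h : L) l := fun h => by
    rw [← h2, map_add, killingForm_cartan_rootSpaces h.2 hm, add_zero]
  set k' : H := ⟨k, hk⟩
  set l' : H := ⟨l, hl⟩
  -- The Cartan parts solve x + d = k and x - d = l. Testing against (V^⊥)_{-Δ} gives x ∈ V^⊥⊥ = V,
  -- and testing against V_Δ gives d ∈ V^⊥.
  refine mem_lagr.mpr ⟨(2⁻¹ : ℂ) • (k' + l'), Submodule.smul_mem _ _ ?_,
    (2⁻¹ : ℂ) • (k' - l'), Submodule.smul_mem _ _ ?_, n, hn, m, hm, ?_⟩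
  · rw [← cartanPerp_cartanPerp hc V, mem_cartanPerp hc]
    intro d hd
    have := hp' ((d : L), -(d : L)) (mem_lagr.mpr ⟨0, zero_mem _, d, hd, 0, zero_mem _,
      0, zero_mem _, by simp⟩)
    simp only [map_neg, LinearMap.neg_apply, hK1, hK2] at this
    simp [k', l', this]
  · rw [mem_cartanPerp hc]
    intro x hx
    have := hp' ((x : L), (x : L)) (mem_lagr.mpr ⟨x, hx, 0, zero_mem _, 0, zero_mem _,
      0, zero_mem _, by simp⟩)
    simp only [hK1, hK2] at this
    simp [k', l', this]
  · refine Prod.ext ?_ ?_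
    · rw [← h1]
      push_cast
      change _ = (2⁻¹ : ℂ) • (k + l) + (2⁻¹ : ℂ) • (k - l) + _
      module
    · rw [← h2]
      push_cast
      change _ = (2⁻¹ : ℂ) • (k + l) - (2⁻¹ : ℂ) • (k - l) + _
      module

lemma isLagrangian_lagr (hc : c ≠ 0) (V : Submodule ℂ H) (u v : (rootSystem H).weylGroup) :
    IsLagrangian (doubleForm L c) (lagr c b V u v) where
  lie_mem := isLieClosed_lagr V u v
  isotropic _ hp _ hq := isotropic_lagr hc V u v hp hq
  two_mul_finrank := by
    have hrefl : (doubleForm L c).IsRefl := fun p q h => by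
      rw [doubleForm_apply] at h ⊢
      rw [killingForm_comm q.1, killingForm_comm q.2, h]
    have hnd : (doubleForm L c).Nondegenerate := by
      refine hrefl.nondegenerate_iff_separatingLeft.mpr fun p hp => ?_
      refine Prod.ext (eq_zero_of_killingForm_eq_zero fun y => ?_)
        (eq_zero_of_killingForm_eq_zero fun y => ?_)
      · simpa [doubleForm_apply, hc] using hp (y, 0)
      · simpa [doubleForm_apply, hc] using hp (0, y)
    have horth : (doubleForm L c).orthogonal (lagr c b V u v) = lagr c b V u v :=
      le_antisymm (fun p hp => mem_lagr_of_orthogonal hc V u v fun q hq => hp q hq)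
        fun p hp q hq => isotropic_lagr hc V u v hq hp
    have h1 := LinearMap.BilinForm.finrank_orthogonal hnd (lagr c b V u v)
    have h2 := Submodule.finrank_le (lagr c b V u v)
    rw [horth] at h1
    lia

/-! ### The coisotropic subalgebras attached to `𝔩_{V,u,v}` -/

/-- This is 𝔤_Δ ∩ 𝔤* = 0. Equality of h + n and -h + m puts 2h in the sum of the root spaces, so h =
0 and x ∈ 𝔫 ∩ 𝔫₋ = 0. -/
lemma eq_zero_of_diag_mem_stdDual {x : L} (hx : (x, x) ∈ stdDual b) : x = 0 := by
  obtain ⟨h, hh, n, hn, m, hm, e⟩ := mem_stdDual.mp hx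
  have e1 := (Prod.ext_iff.mp e).1
  have e2 := (Prod.ext_iff.mp e).2
  simp only at e1 e2
  have h2 : (2 : ℂ) • h = m - n := by
    rw [two_smul]
    have := e1.symm.trans e2
    rw [eq_sub_iff_add_eq, add_assoc, this]
    abel
  have h0 : (2 : ℂ) • h = 0 := eq_zero_of_mem_cartan_of_mem_rootSpaces (H := H)
    (S := Set.univ) (H.smul_mem _ hh) (h2 ▸ sub_mem (rootSpaces_mono (Set.subset_univ _) hm)
      (rootSpaces_mono (Set.subset_univ _) hn))
  have hh0 : h = 0 := (smul_eq_zero.mp h0).resolve_left two_ne_zero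
  rw [hh0, zero_add] at e1
  rw [hh0, neg_zero, zero_add] at e2
  refine eq_zero_of_mem_rootSpaces_of_mem_rootSpaces ?_ (e1 ▸ hn) (e2 ▸ hm)
  rw [Set.disjoint_left]
  intro α hα hα'
  rw [mem_smul_posRoots_iff] at hα
  rw [mem_smul_negRoots_iff] at hα'
  exact hα' hα

lemma disjoint_diag_perp (m : Submodule ℂ L) : Disjoint (diag m) (perp c b m) := by
  rw [Submodule.disjoint_def]
  rintro ⟨x, y⟩ hx hp
  obtain ⟨-, rfl⟩ : x ∈ m ∧ y = x := mem_diag.mp hx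
  rw [eq_zero_of_diag_mem_stdDual hp.1]
  rfl

/-- If `𝔪_Δ + 𝔪^⊥` is closed under the bracket, then `𝔪` is a coisotropic subalgebra. -/
lemma isCoisotropic_of_isLieClosed {m : Submodule ℂ L} (h : IsLieClosed (diag m ⊔ perp c b m)) :
    IsCoisotropic c b m where
  lie_mem := fun x hx y hy => by
    have h1 := h (x, x) (Submodule.mem_sup_left (mem_diag.mpr ⟨hx, rfl⟩))
      (y, y) (Submodule.mem_sup_left (mem_diag.mpr ⟨hy, rfl⟩))
    obtain ⟨p, hp, q, hq, e⟩ := Submodule.mem_sup.mp h1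
    obtain ⟨hp1, hp2⟩ := mem_diag.mp hp
    rw [LieAlgebra.Prod.bracket_apply, Prod.ext_iff] at e
    have e1 : p.1 + q.1 = ⁅x, y⁆ := e.1
    have e2 : p.2 + q.2 = ⁅x, y⁆ := e.2
    -- The 𝔪^⊥-part of a diagonal element is itself diagonal, hence zero.
    have hq2 : q.2 = q.1 := by
      rw [hp2, ← e1] at e2
      exact add_left_cancel e2
    have hq0 : q.1 = 0 := eq_zero_of_diag_mem_stdDual (b := b) (by
      have : (q.1, q.1) = q := Prod.ext rfl hq2.symm
      rw [this]
      exact hq.1)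
    rw [← e1, hq0, add_zero]
    exact hp1
  perp_lie_mem := fun p hp q hq => by
    have h1 : ⁅p, q⁆ ∈ stdDual b := by
      have hs := stdDual_eq_lagr b (one_ne_zero (α := ℂ))
      rw [hs]
      exact isLieClosed_lagr _ _ _ p (hs ▸ hp.1) q (hs ▸ hq.1)
    obtain ⟨z, hz, r, hr, e⟩ := Submodule.mem_sup.mp
      (h p (Submodule.mem_sup_right hp) q (Submodule.mem_sup_right hq))
    -- 𝔤* is closed under the bracket, so the diagonal part of [p, q] lies in 𝔤* as well and
    -- vanishes.
    have hz' : z ∈ stdDual b := by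
      rw [← add_sub_cancel_right z r, e]
      exact sub_mem h1 hr.1
    have hz2 : (z.1, z.1) = z := Prod.ext rfl (mem_diag.mp hz).2.symm
    have hz1 : z.1 = 0 := eq_zero_of_diag_mem_stdDual (b := b) (by rwa [hz2])
    have hz0 : z = 0 := by
      rw [← hz2, hz1]
      rfl
    rw [← e, hz0, zero_add]
    exact hr

section

variable {V : Submodule ℂ H} {u v : (rootSystem H).weylGroup}

lemma coisotropicOf_le {p : Submodule ℂ L} (hV : ∀ x ∈ V, (x : L) ∈ p)
    (hu : ∀ α ∈ inversions b u, ∀ x ∈ rootSpace H ((negRoot α).1 : H → ℂ), x ∈ p)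
    (hv : ∀ α ∈ inversions b v, ∀ x ∈ rootSpace H (α.1 : H → ℂ), x ∈ p) :
    coisotropicOf b V u v ≤ p := by
  refine sup_le (sup_le ?_ (rootSpaces_le ?_)) (rootSpaces_le hv)
  · rw [Submodule.map_le_iff_le_comap]
    exact hV
  · rintro _ ⟨α, hα, rfl⟩
    exact hu α hα

lemma cartan_mem_coisotropicOf {x : H} (hx : x ∈ V) : (x : L) ∈ coisotropicOf b V u v :=
  Submodule.mem_sup_left (Submodule.mem_sup_left ⟨x, hx, rfl⟩)

lemma mem_coisotropicOf_left {α : H.root} (hα : α ∈ inversions b u) {x : L}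
    (hx : x ∈ rootSpace H ((negRoot α).1 : H → ℂ)) : x ∈ coisotropicOf b V u v :=
  Submodule.mem_sup_left (Submodule.mem_sup_right (mem_rootSpaces (Set.mem_image_of_mem _ hα) hx))

lemma mem_coisotropicOf_right {α : H.root} (hα : α ∈ inversions b v) {x : L}
    (hx : x ∈ rootSpace H (α.1 : H → ℂ)) : x ∈ coisotropicOf b V u v :=
  Submodule.mem_sup_right (mem_rootSpaces hα hx)

lemma mem_posNilp_one {α : H.root} (hα : α ∈ posRoots b) {x : L}
    (hx : x ∈ rootSpace H (α.1 : H → ℂ)) : x ∈ posNilp b 1 :=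
  mem_rootSpaces (by rwa [mem_smul_posRoots_iff, inv_one, one_smul]) hx

lemma mem_negNilp_one {α : H.root} (hα : α ∉ posRoots b) {x : L}
    (hx : x ∈ rootSpace H (α.1 : H → ℂ)) : x ∈ negNilp b 1 :=
  mem_rootSpaces (by rwa [mem_smul_negRoots_iff, inv_one, one_smul]) hx

lemma cartan_mem_perp (hc : c ≠ 0) {d : H} (hd : d ∈ cartanPerp c V) :
    ((d : L), -(d : L)) ∈ perp c b (coisotropicOf b V u v) := by
  refine ⟨mem_stdDual.mpr ⟨d, d.2, 0, zero_mem _, 0, zero_mem _, by simp⟩, fun z hz => ?_⟩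
  have : coisotropicOf b V u v ≤ LinearMap.ker (killingForm ℂ L (d : L)) := by
    refine coisotropicOf_le (fun x hx => ?_)
      (fun α _ x hx => killingForm_cartan_rootSpace d.2 hx)
      (fun α _ x hx => killingForm_cartan_rootSpace d.2 hx)
    rw [LinearMap.mem_ker, killingForm_comm]
    exact (mem_cartanPerp hc).mp hd x hx
  have h0 : killingForm ℂ L (d : L) z = 0 := this hz
  simp [doubleForm_apply, h0]

/-- 𝔤_α pairs only with 𝔤_{-α}, and for positive α this is a summand of 𝔪 only when α ∈ Φ_u. -/
lemma pos_mem_perp {α : H.root} (hα : α ∈ posRoots b) (hα' : α ∉ inversions b u) {x : L}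
    (hx : x ∈ rootSpace H (α.1 : H → ℂ)) : (x, (0 : L)) ∈ perp c b (coisotropicOf b V u v) := by
  refine ⟨mem_stdDual.mpr ⟨0, H.zero_mem, x, mem_posNilp_one hα hx, 0, zero_mem _, by simp⟩,
    fun z hz => ?_⟩
  have : coisotropicOf b V u v ≤ LinearMap.ker (killingForm ℂ L x) := by
    refine coisotropicOf_le (fun k _ => ?_) (fun γ hγ y hy => ?_) (fun γ hγ y hy => ?_)
    · rw [LinearMap.mem_ker, killingForm_comm]
      exact killingForm_cartan_rootSpace k.2 hx
    · exact killingForm_rootSpace_rootSpace hx hy fun e => hα' (negRoot_injective e ▸ hγ)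
    · refine killingForm_rootSpace_rootSpace hx hy fun e => ?_
      exact (negRoot_mem_posRoots_iff b α).mp (e ▸ hγ.1) hα
  have h0 : killingForm ℂ L x z = 0 := this hz
  simp [doubleForm_apply, h0]

lemma neg_mem_perp {α : H.root} (hα : α ∈ posRoots b) (hα' : α ∉ inversions b v) {x : L}
    (hx : x ∈ rootSpace H ((negRoot α).1 : H → ℂ)) :
    ((0 : L), x) ∈ perp c b (coisotropicOf b V u v) := by
  have hneg : negRoot α ∉ posRoots b := fun h => (negRoot_mem_posRoots_iff b α).mp h hα
  refine ⟨mem_stdDual.mpr ⟨0, H.zero_mem, 0, zero_mem _, x, mem_negNilp_one hneg hx, by simp⟩,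
    fun z hz => ?_⟩
  have : coisotropicOf b V u v ≤ LinearMap.ker (killingForm ℂ L x) := by
    refine coisotropicOf_le (fun k _ => ?_) (fun γ hγ y hy => ?_) (fun γ hγ y hy => ?_)
    · rw [LinearMap.mem_ker, killingForm_comm]
      exact killingForm_cartan_rootSpace k.2 hx
    · refine killingForm_rootSpace_rootSpace hx hy fun e => hneg ?_
      rw [← negRoot_injective e]
      exact hγ.1
    · refine killingForm_rootSpace_rootSpace hx hy fun e => hα' ?_
      rw [negRoot_negRoot] at e
      exact e ▸ hγ
  have h0 : killingForm ℂ L x z = 0 := this hz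
  simp [doubleForm_apply, h0]

/-- Pairing with V puts the Cartan part in V^⊥. Pairing with 𝔤_{-α}, α ∈ Φ_u, removes from 𝔫 the
roots outside uΦ⁺; pairing with 𝔤_α, α ∈ Φ_v, removes from 𝔫₋ the roots outside vΦ⁻. -/
lemma perp_coisotropicOf_le (hc : c ≠ 0) :
    perp c b (coisotropicOf b V u v) ≤ lagr c b V u v := by
  rintro p ⟨hp, hz⟩
  obtain ⟨h, hh, n, hn, m, hm, rfl⟩ := mem_stdDual.mp hp
  have hz' : ∀ z ∈ coisotropicOf b V u v,
      killingForm ℂ L (h + n) z = killingForm ℂ L (-h + m) z := fun z hz0 => by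
    have := hz z hz0
    rw [doubleForm_apply] at this
    exact sub_eq_zero.mp ((mul_eq_zero.mp this).resolve_left hc)
  refine mem_lagr.mpr ⟨0, zero_mem _, ⟨h, hh⟩, ?_, n, ?_, m, ?_, by simp⟩
  · rw [mem_cartanPerp hc]
    intro x hx
    have h1 := hz' x (cartan_mem_coisotropicOf hx)
    rw [killingForm_comm, killingForm_comm (-h + m), map_add, map_add, map_neg,
      killingForm_cartan_rootSpaces x.2 hn, killingForm_cartan_rootSpaces x.2 hm] at h1
    linear_combination h1 / 2
  · refine mem_rootSpaces_of_orthogonal hn fun α hα hα' y hy => ?_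
    rw [mem_smul_posRoots_iff, inv_one, one_smul] at hα
    rw [mem_smul_posRoots_iff] at hα'
    have h1 := hz' y (mem_coisotropicOf_left ((mem_inversions_iff b u α).mpr ⟨hα, hα'⟩) hy)
    rw [map_add, map_add, map_neg, LinearMap.add_apply, LinearMap.add_apply, LinearMap.neg_apply,
      killingForm_cartan_rootSpace hh hy, killingForm_comm m,
      killingForm_rootSpace_rootSpaces hy ?_ hm] at h1
    · simpa using h1
    · rw [negRoot_negRoot, mem_smul_negRoots_iff]
      simpa using hα
  · refine mem_rootSpaces_of_orthogonal hm fun α hα hα' y hy => ?_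
    rw [mem_smul_negRoots_iff, inv_one, one_smul, ← negRoot_mem_posRoots_iff] at hα
    rw [mem_smul_negRoots_iff, ← negRoot_mem_posRoots_iff, ← smul_negRoot] at hα'
    have h1 := hz' y (mem_coisotropicOf_right ((mem_inversions_iff b v _).mpr ⟨hα, hα'⟩) hy)
    rw [map_add, map_add, map_neg, LinearMap.add_apply, LinearMap.add_apply, LinearMap.neg_apply,
      killingForm_cartan_rootSpace hh hy, killingForm_comm n,
      killingForm_rootSpace_rootSpaces hy ?_ hn] at h1
    · simpa using h1.symm
    · rw [negRoot_negRoot, mem_smul_posRoots_iff, inv_one, one_smul]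
      exact (negRoot_mem_posRoots_iff b α).mp hα

/-- (𝔤_α)_Δ lies in 𝔩 as soon as α ∈ uΦ⁺ ∩ vΦ⁻. Disjointness puts both -Φ_u and Φ_v in this
intersection. -/
lemma diag_coisotropicOf_le (huv : Disjoint (inversions b u) (inversions b v)) :
    diag (coisotropicOf b V u v) ≤ lagr c b V u v := by
  rw [diag, Submodule.map_le_iff_le_comap]
  have hmem : ∀ α : H.root, u⁻¹ • α ∈ posRoots b → v⁻¹ • α ∉ posRoots b →
      ∀ x ∈ rootSpace H (α.1 : H → ℂ), (x, x) ∈ lagr c b V u v := fun α h1 h2 x hx =>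
    mem_lagr.mpr ⟨0, zero_mem _, 0, zero_mem _,
      x, mem_rootSpaces ((mem_smul_posRoots_iff b u α).mpr h1) hx,
      x, mem_rootSpaces ((mem_smul_negRoots_iff b v α).mpr h2) hx, by simp⟩
  refine coisotropicOf_le (fun x hx => ?_) (fun α hα => hmem _ ?_ ?_) (fun α hα => hmem _ ?_ ?_)
  · exact mem_lagr.mpr ⟨x, hx, 0, zero_mem _, 0, zero_mem _, 0, zero_mem _, by simp⟩
  · rw [smul_negRoot, negRoot_mem_posRoots_iff]
    exact ((mem_inversions_iff b u α).mp hα).2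
  · have := Set.disjoint_left.mp huv hα
    rw [mem_inversions_iff] at this
    rw [smul_negRoot, negRoot_mem_posRoots_iff, not_not]
    by_contra h
    exact this ⟨hα.1, h⟩
  · have := Set.disjoint_right.mp huv hα
    rw [mem_inversions_iff] at this
    by_contra h
    exact this ⟨hα.1, h⟩
  · exact ((mem_inversions_iff b v α).mp hα).2

lemma lagr_le (hc : c ≠ 0) (huv : Disjoint (inversions b u) (inversions b v)) :
    lagr c b V u v ≤
      diag (coisotropicOf b V u v) ⊔ perp c b (coisotropicOf b V u v) := by
  set l := diag (coisotropicOf b V u v) ⊔ perp c b (coisotropicOf b V u v)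
  have hd : ∀ x ∈ coisotropicOf b V u v, (x, x) ∈ l := fun x hx =>
    Submodule.mem_sup_left (mem_diag.mpr ⟨hx, rfl⟩)
  have hn : posNilp b u ≤ l.comap (LinearMap.inl ℂ L L) := by
    refine rootSpaces_le fun α hα x hx => ?_
    rw [mem_smul_posRoots_iff] at hα
    by_cases hpos : α ∈ posRoots b
    · exact Submodule.mem_sup_right
        (pos_mem_perp hpos (fun h => ((mem_inversions_iff b u α).mp h).2 hα) hx)
    · have hinv : negRoot α ∈ inversions b u := by
        rw [mem_inversions_iff, smul_negRoot, negRoot_mem_posRoots_iff, negRoot_mem_posRoots_iff,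
          not_not]
        exact ⟨hpos, hα⟩
      rw [← negRoot_negRoot α] at hx
      -- For a negative root of uΦ⁺, write (x, 0) = (x, x) - (0, x). Disjointness places (0, x) in
      -- 𝔪^⊥.
      have h1 := sub_mem (hd x (mem_coisotropicOf_left hinv hx)) (Submodule.mem_sup_right
        (neg_mem_perp hinv.1 (Set.disjoint_left.mp huv hinv) hx))
      simpa using h1
  have hm : negNilp b v ≤ l.comap (LinearMap.inr ℂ L L) := by
    refine rootSpaces_le fun α hα x hx => ?_
    rw [mem_smul_negRoots_iff] at hα
    by_cases hpos : α ∈ posRoots b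
    · have hinv : α ∈ inversions b v := (mem_inversions_iff b v α).mpr ⟨hpos, hα⟩
      have h1 := sub_mem (hd x (mem_coisotropicOf_right hinv hx)) (Submodule.mem_sup_right
        (pos_mem_perp hpos (Set.disjoint_right.mp huv hinv) hx))
      simpa using h1
    · rw [← negRoot_negRoot α] at hx
      refine Submodule.mem_sup_right
        (neg_mem_perp ((negRoot_mem_posRoots_iff b α).mpr hpos) (fun h => ?_) hx)
      rw [mem_inversions_iff, smul_negRoot, negRoot_mem_posRoots_iff (α := v⁻¹ • α)] at h
      exact h.2 hα
  intro p hp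
  obtain ⟨x, hx, d, hd', n, hn', m, hm', rfl⟩ := mem_lagr.mp hp
  have := add_mem (add_mem (add_mem (hd x (cartan_mem_coisotropicOf hx))
    (Submodule.mem_sup_right (cartan_mem_perp hc hd'))) (hn hn')) (hm hm')
  convert! this using 1
  ext <;> simp [sub_eq_add_neg]

/-- If `Φ_u ∩ Φ_v = ∅`, then `𝔩_{V,u,v}` is attached to
`V + ⨁_{α ∈ Φ_u} 𝔤_{-α} + ⨁_{α ∈ Φ_v} 𝔤_α`. -/
theorem corresponds_coisotropicOf (hc : c ≠ 0)
    (huv : Disjoint (inversions b u) (inversions b v)) :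
    Corresponds c b (lagr c b V u v) (coisotropicOf b V u v) := by
  have heq : diag (coisotropicOf b V u v) ⊔ perp c b (coisotropicOf b V u v) = lagr c b V u v :=
    le_antisymm (sup_le (diag_coisotropicOf_le huv) (perp_coisotropicOf_le hc)) (lagr_le hc huv)
  exact ⟨isCoisotropic_of_isLieClosed (heq ▸ isLieClosed_lagr V u v), heq,
    disjoint_diag_perp _⟩

end

/-! ### The two subalgebras of a long root -/

lemma coisotropicOf_one_left (V : Submodule ℂ H) (v : (rootSystem H).weylGroup) :
    coisotropicOf b V 1 v = V.map H.toSubmodule.subtype ⊔ rootSpaces (inversions b v) := by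
  rw [coisotropicOf, inversions_one, Set.image_empty, rootSpaces_empty, sup_bot_eq]

lemma coisotropicOf_one_right (V : Submodule ℂ H) (u : (rootSystem H).weylGroup) :
    coisotropicOf b V u 1 =
      V.map H.toSubmodule.subtype ⊔ rootSpaces (negRoot '' inversions b u) := by
  rw [coisotropicOf, inversions_one, rootSpaces_empty, sup_bot_eq]

lemma corootLine_negRoot (β : H.root) : corootLine (negRoot β) = corootLine β := by
  rw [corootLine, corootLine, coroot_negRoot, ← Set.neg_singleton, Submodule.span_neg]

lemma signChanges_of_pos {β : H.root} (hpos : β ∈ posRoots b) :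
    signChanges b β = inversions b (reflectionOf β) := by
  ext γ
  rw [mem_inversions_iff, reflectionOf_inv]
  simp only [signChanges, Set.mem_ofPred_eq, hpos, iff_true, not_true_eq_false, iff_false]

lemma reflectionOf_negRoot_smul (β γ : H.root) :
    reflectionOf (negRoot β) • γ = reflectionOf β • γ := by
  apply root_ext
  rw [coe_reflectionOf_smul, coe_reflectionOf_smul, coroot_negRoot, coe_negRoot]
  have h2 : γ.1 (-coroot β.1) = -γ.1 (coroot β.1) := map_neg γ.1.toLinear _
  rw [h2]
  module

lemma signChanges_negRoot_of_pos {β : H.root} (hpos : β ∈ posRoots b) :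
    signChanges b (negRoot β) = negRoot '' inversions b (reflectionOf β) := by
  have hneg : negRoot β ∉ posRoots b := fun h => (negRoot_mem_posRoots_iff b β).mp h hpos
  have key : ∀ γ, γ ∈ signChanges b (negRoot β) ↔ negRoot γ ∈ inversions b (reflectionOf β) := by
    intro γ
    rw [mem_inversions_iff, reflectionOf_inv, smul_negRoot, negRoot_mem_posRoots_iff,
      negRoot_mem_posRoots_iff, not_not]
    simp only [signChanges, Set.mem_ofPred_eq, hneg, iff_false, not_false_eq_true, iff_true,
      reflectionOf_negRoot_smul]
  ext γ
  rw [key]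
  constructor
  · exact fun h => ⟨_, h, negRoot_negRoot γ⟩
  · rintro ⟨ε, hε, rfl⟩
    rwa [negRoot_negRoot]

section

variable {E : H.root → L} (hE : IsChevalley E) {β : H.root} (hpos : β ∈ posRoots b)
  (hlong : IsLong β)
include hE hpos hlong

lemma zambon_eq_coisotropicOf :
    zambon b E β = coisotropicOf b (corootLine β) 1 (reflectionOf β) := by
  rw [zambon_eq (fun γ h h' => hlong.apply_coroot_eq h h') hE, signChanges_of_pos hpos,
    coisotropicOf_one_left]

lemma zambon_negRoot_eq_coisotropicOf :
    zambon b E (negRoot β) = coisotropicOf b (corootLine β) (reflectionOf β) 1 := by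
  -- The image formula is applied to δ = -β: the Cartan integers only change sign, so the bound for
  -- β carries over.
  rw [zambon_eq (fun γ h h' => ?_) hE, signChanges_negRoot_of_pos hpos, corootLine_negRoot,
    coisotropicOf_one_right]
  have h2 : γ.1 (-coroot β.1) = -γ.1 (coroot β.1) := map_neg γ.1.toLinear _
  rw [negRoot_negRoot] at h'
  rw [coroot_negRoot, h2]
  rcases hlong.apply_coroot_eq h' h with h | h | h <;> rw [h] <;> simp

end

end Coisotropic

end

theorem mainTheorem2 {L : Type*} [LieRing L] [LieAlgebra ℂ L] [FiniteDimensional ℂ L]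
    [LieAlgebra.IsSemisimple ℂ L] (H : LieSubalgebra ℂ L) [H.IsCartanSubalgebra]
    (b : (rootSystem H).Base) (E : H.root → L) (hE : IsChevalley E)
    (c : ℂ) (hc : c ≠ 0) (β : H.root) (hpos : β ∈ posRoots b) (hlong : IsLong β) :
    -- the two formulas
    (diag (zambon b E β) ⊔ perp c b (zambon b E β) =
        lagr c b (corootLine β) 1 (reflectionOf β)) ∧
    (diag (zambon b E (negRoot β)) ⊔ perp c b (zambon b E (negRoot β)) =
        lagr c b (corootLine β) (reflectionOf β) 1) ∧
    -- both subspaces lie in `𝒞ℒ(𝔤 ⊕ 𝔤)`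
    (diag (zambon b E β) ⊔ perp c b (zambon b E β) ∈ CL c b) ∧
    (diag (zambon b E (negRoot β)) ⊔ perp c b (zambon b E (negRoot β)) ∈ CL c b) ∧
    -- `Φ_w ∩ Φ_e = ∅` for all `w`, and `𝔲_β`, `𝔲_{-β}` are the coisotropic subalgebras
    -- attached to `𝔩_{ℂH_β, e, s_β}` and `𝔩_{ℂH_β, s_β, e}`
    (∀ w : (rootSystem H).weylGroup, inversions b w ∩ inversions b 1 = ∅) ∧
    Corresponds c b (lagr c b (corootLine β) 1 (reflectionOf β)) (zambon b E β) ∧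
    Corresponds c b (lagr c b (corootLine β) (reflectionOf β) 1) (zambon b E (negRoot β)) ∧
    zambon b E β = coisotropicOf b (corootLine β) 1 (reflectionOf β) ∧
    zambon b E (negRoot β) = coisotropicOf b (corootLine β) (reflectionOf β) 1 := by
  have hβ := zambon_eq_coisotropicOf hE hpos hlong
  have hβ' := zambon_negRoot_eq_coisotropicOf hE hpos hlong
  have h1 : Corresponds c b (lagr c b (corootLine β) 1 (reflectionOf β)) (zambon b E β) :=
    hβ ▸ corresponds_coisotropicOf hc (by rw [inversions_one]; exact Set.empty_disjoint _)
  have h2 : Corresponds c b (lagr c b (corootLine β) (reflectionOf β) 1)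
      (zambon b E (negRoot β)) :=
    hβ' ▸ corresponds_coisotropicOf hc (by rw [inversions_one]; exact Set.disjoint_empty _)
  refine ⟨h1.sup_eq, h2.sup_eq, ?_, ?_, fun w => ?_, h1, h2, hβ, hβ'⟩
  · rw [h1.sup_eq]
    exact ⟨isLagrangian_lagr hc _ _ _, _, h1⟩
  · rw [h2.sup_eq]
    exact ⟨isLagrangian_lagr hc _ _ _, _, h2⟩
  · rw [inversions_one, Set.inter_empty]
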